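/- Let $n\in\mathbb N$, let $(\Omega,\mathcal F,\mathbb P)$ be a probability space, and let $(\tau_k)_{k\in\mathbb Z}$ be an ergodic group of measure preserving transformations of $\Omega$: $\tau_0=\mathrm{id}$, $\tau_{k+k'}=\tau_k\circ\tau_{k'}$, $\mathbb P[\tau_k\mathcal U]=\mathbb P[\mathcal U]$ for $\mathcal U\in\mathcal F$ (the $\tau_k$ being measurable), and every $\mathcal U\in\mathcal F$ with $\tau_k(\mathcal U)=\mathcal U$ for all $k\in\mathbb Z$ has $\mathbb P[\mathcal U]\in\{0,1\}$. Let $a:\mathbb R^n\times\mathbb R\times\Omega\to\mathbb R$ satisfy the following assumption (A): (A0) $a$ is measurable with respect to $\mathcal B(\mathbb R^{n+1})\otimes\mathcal F$; (A1) $a(x+l,t,\tau_k\omega)=a(x,t+k,\omega)$ for all $x\in\mathbb R^n$, $l\in\mathbb Z^n$, $t\in\mathbb R$, $k\in\mathbb Z$, $\omega\in\Omega$; (A2) for each $\omega\in\Omega$ the function $a(\cdot,\cdot,\omega)$ is bounded and Lipschitz continuous on $\mathbb R^{n+1}$, and there are $\alpha,\beta>0$ such that $\alpha\le a(x,t,\omega)\le\beta$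 for all $(x,t)\in\mathbb R^{n+1}$ and $\omega\in\Omega$. Let $Y=[0,1]^n$, and for $t\ge 0$ and $\omega\in\Omega$ let $\mathcal R_t(Y)(\omega)$ be the set of all $\gamma(t)$, where $\gamma:[0,t]\to\mathbb R^n$ is absolutely continuous with $\gamma(0)\in Y$ and $|\gamma'(r)|\le a(\gamma(r),r,\omega)$ for a.e. $r\in[0,t]$. Then there exist a non-empty, compact and convex set $D\subset\mathbb R^n$ (not depending on $\omega$) and an event $\widetilde\Omega\in\mathcal F$ with $\mathbb P[\widetilde\Omega]=1$ such that, for every $\omega\in\widetilde\Omega$, the sets $\mathcal R_t(Y)(\omega)$, $t\ge0$, are non-empty and compact and $$\lim_{t\to\infty}\frac{\mathcal R_t(Y)(\omega)}{t}=D$$ in the Hausdorff metric on the non-empty compact subsets of $\mathbb R^n$. -/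

import Mathlib

open MeasureTheory Set Filter Topology
open scoped NNReal Pointwise

/-- `(τ k)`, `k ∈ ℤ`, is an ergodic group of measure preserving transformations of the
probability space `(Ω, μ)`. -/
structure IsErgodicGroup {Ω : Type*} [MeasurableSpace Ω] (μ : Measure Ω) (τ : ℤ → Ω → Ω) :
    Prop where
  map_zero : τ 0 = id
  map_add : ∀ k k' : ℤ, τ (k + k') = τ k ∘ τ k'
  measurePreserving : ∀ k : ℤ, MeasurePreserving (τ k) μ μ
  ergodic : ∀ U : Set Ω, MeasurableSet U → (∀ k : ℤ, τ k '' U = U) → μ U = 1 ∨ μ U = 0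

/-- The integer vector `l ∈ ℤⁿ` as a point of Euclidean space. -/
noncomputable def latticePoint {n : ℕ} (l : Fin n → ℤ) : EuclideanSpace ℝ (Fin n) :=
  WithLp.toLp 2 (fun i => (l i : ℝ))

/-- The standing assumptions on the velocity `a(x, t, ω)`: joint measurability,
`ℤⁿ`-periodicity in `x` together with stationarity in `t`, (bounded) Lipschitz continuity in
`(x, t)` for each `ω`, and positive lower and upper bounds uniform in `(x, t, ω)`. -/
structure VelocityAssumption {n : ℕ} {Ω : Type*} [MeasurableSpace Ω] (τ : ℤ → Ω → Ω)
    (a : EuclideanSpace ℝ (Fin n) → ℝ → Ω → ℝ) : Prop where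
  measurable : Measurable
    (fun p : (EuclideanSpace ℝ (Fin n) × ℝ) × Ω => a p.1.1 p.1.2 p.2)
  periodic_stationary : ∀ (x : EuclideanSpace ℝ (Fin n)) (l : Fin n → ℤ) (t : ℝ) (k : ℤ) (ω : Ω),
    a (x + latticePoint l) t (τ k ω) = a x (t + k) ω
  lipschitz : ∀ ω : Ω, ∃ K : ℝ≥0,
    LipschitzWith K (fun p : EuclideanSpace ℝ (Fin n) × ℝ => a p.1 p.2 ω)
  bounds : ∃ α β : ℝ, 0 < α ∧ 0 < β ∧
    ∀ (x : EuclideanSpace ℝ (Fin n)) (t : ℝ) (ω : Ω), α ≤ a x t ω ∧ a x t ω ≤ β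

/-- The admissible paths on `[s, t]`: absolutely continuous `γ` with
`|γ'(r)| ≤ a(γ(r), r, ω)` for almost every `r ∈ [s, t]`. Paths are represented by functions on
`ℝ` whose values outside `[s, t]` are irrelevant. -/
def admissiblePaths {n : ℕ} {Ω : Type*} (a : EuclideanSpace ℝ (Fin n) → ℝ → Ω → ℝ)
    (s t : ℝ) (ω : Ω) : Set (ℝ → EuclideanSpace ℝ (Fin n)) :=
  {γ | AbsolutelyContinuousOnInterval γ s t ∧
    ∀ᵐ r ∂(volume.restrict (Icc s t)), DifferentiableAt ℝ γ r ∧ ‖deriv γ r‖ ≤ a (γ r) r ω}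

/-- The set of points reachable at time `t` from the point `x` at time `s`. -/
def reachableSet {n : ℕ} {Ω : Type*} (a : EuclideanSpace ℝ (Fin n) → ℝ → Ω → ℝ)
    (t : ℝ) (x : EuclideanSpace ℝ (Fin n)) (s : ℝ) (ω : Ω) : Set (EuclideanSpace ℝ (Fin n)) :=
  {y | ∃ γ ∈ admissiblePaths a s t ω, γ s = x ∧ γ t = y}

/-- The unit cell `Y = [0,1]ⁿ`. -/
def unitCell (n : ℕ) : Set (EuclideanSpace ℝ (Fin n)) :=
  {x | ∀ i, x i ∈ Icc (0 : ℝ) 1}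

/-- The enlarged reachable set: points reachable at time `t` from the unit cell at time `s`. -/
def enlargedReachableSet {n : ℕ} {Ω : Type*} (a : EuclideanSpace ℝ (Fin n) → ℝ → Ω → ℝ)
    (t s : ℝ) (ω : Ω) : Set (EuclideanSpace ℝ (Fin n)) :=
  ⋃ x ∈ unitCell n, reachableSet a t x s ω

/-! Let `R t ω` be the set reached from the origin at time `t`. Since the speed is at least `α` and
the velocity is `ℤⁿ`-periodic, a path can, within a fixed time `T` with `√n ≤ α * T`, move from any
point onto a lattice translate of any other path and follow it from then on. So displacements hardly
depend on the starting point, and `R (N + t) ω` agrees with the Minkowski sum `R N ω + R t (τ N ω)`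
up to the fixed error `β * T + √n`, in both directions (`Reach.exists_near_displacement`,
`NearSubset`).

Two consequences carry the proof. First, for each `p` the support function `h N ω` of `R N ω` is
additive along the orbit up to a bounded error. Summing `h N (τ j ω)` over `j < k` telescopes to `N
* h k ω`, with an error at most a constant times `k` plus a term independent of `k`. Because the
defect is bounded on both sides, Birkhoff's theorem suffices in place of a subadditive one: `h k ω /
k` is eventually within `c / N + ε` of `𝔼[h N] / N` for every large `N`, hence converges almost
surely to a deterministic `H p`. Measurability of `h N` comes from a countable discretisation of the
paths.

Second, `R (m * N) ω` is within `O(m)` of a sum of `m` sets of radius `β * N`, and such a sum is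
within `O(√m * N)` of its convex hull. Taking `N` large, then `m` large, the rescaled sets become
convex. Bounded sets that are asymptotically convex and whose support functions converge pointwise
converge in the Hausdorff metric, the limit being the Wulff shape of `H`. Starting from the unit
cell instead of the origin costs a bounded error. -/

/-! ### Birkhoff's ergodic theorem via the maximal inequality. -/

section Birkhoff

variable {Ω : Type*} {T : Ω → Ω} {f : Ω → ℝ}

/-- The running maximum of the Birkhoff sums of `f` of length at most `n`. -/
noncomputable def birkhoffMax (T : Ω → Ω) (f : Ω → ℝ) : ℕ → Ω → ℝ
  | 0 => fun _ => 0
  | n + 1 => fun x => max 0 (f x + birkhoffMax T f n (T x))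

lemma birkhoffMax_nonneg (n : ℕ) (x : Ω) : 0 ≤ birkhoffMax T f n x := by
  cases n with
  | zero => exact le_rfl
  | succ n => exact le_max_left _ _

lemma birkhoffMax_le_succ (n : ℕ) (x : Ω) :
    birkhoffMax T f n x ≤ birkhoffMax T f (n + 1) x := by
  induction n generalizing x with
  | zero => exact le_max_left _ _
  | succ n ih => exact max_le_max le_rfl (add_le_add le_rfl (ih _))

lemma birkhoffSum_le_birkhoffMax (n : ℕ) (x : Ω) :
    birkhoffSum T f n x ≤ birkhoffMax T f n x := by
  induction n generalizing x with
  | zero => simp [birkhoffMax]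
  | succ n ih =>
    rw [birkhoffSum_succ']
    exact (add_le_add le_rfl (ih _)).trans (le_max_right _ _)

variable [MeasurableSpace Ω] {μ : Measure Ω}

lemma measurable_birkhoffMax (hT : Measurable T) (hf : Measurable f) (n : ℕ) :
    Measurable (birkhoffMax T f n) := by
  induction n with
  | zero => exact measurable_const
  | succ n ih => exact measurable_const.max (hf.add (ih.comp hT))

lemma integrable_birkhoffMax (hT : MeasurePreserving T μ μ) (hf : Integrable f μ) (n : ℕ) :
    Integrable (birkhoffMax T f n) μ := by
  induction n with
  | zero => exact integrable_zero _ _ _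
  | succ n ih => exact (integrable_zero _ _ _).sup (hf.add (hT.integrable_comp_of_integrable ih))

/-- The maximal ergodic inequality. -/
lemma setIntegral_birkhoffMax_pos_nonneg (hT : MeasurePreserving T μ μ) (hf : Integrable f μ)
    (hfm : Measurable f) (n : ℕ) :
    0 ≤ ∫ x in {x | 0 < birkhoffMax T f n x}, f x ∂μ := by
  cases n with
  | zero => simp [birkhoffMax]
  | succ n =>
    set M := birkhoffMax T f (n + 1) with hM
    have hMm : Measurable M := measurable_birkhoffMax hT.measurable hfm _
    have hA : MeasurableSet {x | 0 < M x} := measurableSet_lt measurable_const hMm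
    have hMi : Integrable M μ := integrable_birkhoffMax hT hf _
    have hMT : Integrable (fun x => M (T x)) μ := hT.integrable_comp_of_integrable hMi
    -- Where `M > 0` the maximum is not the entry `0`, so `M ≤ f + M ∘ T` there. Off this set `M`
    -- vanishes, and `M ∘ T` has the same integral as `M`.
    have h1 : ∫ x in {x | 0 < M x}, (M x - M (T x)) ∂μ ≤ ∫ x in {x | 0 < M x}, f x ∂μ := by
      refine setIntegral_mono_on (hMi.sub hMT).integrableOn hf.integrableOn hA fun x hx => ?_
      have h2 : M x = f x + birkhoffMax T f n (T x) := by
        have h3 : M x = max 0 (f x + birkhoffMax T f n (T x)) := rfl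
        rcases max_choice 0 (f x + birkhoffMax T f n (T x)) with h | h
        · exact absurd (h3.trans h) (ne_of_gt hx)
        · exact h3.trans h
      have h4 : birkhoffMax T f n (T x) ≤ M (T x) := birkhoffMax_le_succ n _
      linarith
    have h5 : ∫ x in {x | 0 < M x}, M x ∂μ = ∫ x, M x ∂μ := by
      refine setIntegral_eq_integral_of_forall_compl_eq_zero fun x hx => ?_
      exact le_antisymm (not_lt.1 hx) (birkhoffMax_nonneg _ _)
    have h6 : ∫ x in {x | 0 < M x}, M (T x) ∂μ ≤ ∫ x, M (T x) ∂μ :=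
      setIntegral_le_integral hMT (Eventually.of_forall fun x => birkhoffMax_nonneg _ _)
    have h7 : ∫ x, M (T x) ∂μ = ∫ x, M x ∂μ := by
      rw [← integral_map hT.measurable.aemeasurable hMm.aestronglyMeasurable (f := M), hT.map_eq]
    rw [integral_sub hMi.integrableOn hMT.integrableOn] at h1
    linarith

/-- The set of points with sums bounded above is `T`-invariant, so it is null or conull. If it were
null, almost every point would have a positive Birkhoff sum, the sets `{0 < birkhoffMax T f n}`
would exhaust the space, and the maximal inequality would force `0 ≤ ∫ f`. -/
lemma ae_bddAbove_birkhoffSum [IsProbabilityMeasure μ] (hT : Ergodic T μ) (hf : Integrable f μ)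
    (hfm : Measurable f) (hneg : ∫ x, f x ∂μ < 0) :
    ∀ᵐ x ∂μ, ∃ B : ℕ, ∀ k, birkhoffSum T f k x ≤ B := by
  have hSm : ∀ k, Measurable (birkhoffSum T f k) := fun k => by
    unfold birkhoffSum
    exact Finset.measurable_fun_sum _ fun i _ =>
      hfm.comp (hT.toMeasurePreserving.measurable.iterate i)
  set U : Set Ω := {x | ∃ B : ℕ, ∀ k, birkhoffSum T f k x ≤ B} with hU
  have hUm : MeasurableSet U := by
    have : U = ⋃ B : ℕ, ⋂ k, {x | birkhoffSum T f k x ≤ B} := by ext; simp [hU]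
    rw [this]
    exact .iUnion fun B => .iInter fun k => measurableSet_le (hSm k) measurable_const
  have hinv : T ⁻¹' U = U := by
    ext x
    simp only [hU, mem_preimage, mem_ofPred_eq]
    constructor
    · rintro ⟨B, hB⟩
      obtain ⟨B', hB'⟩ := exists_nat_ge (f x + B)
      refine ⟨B', fun k => ?_⟩
      cases k with
      | zero => simp
      | succ k => rw [birkhoffSum_succ']; linarith [hB k]
    · rintro ⟨B, hB⟩
      obtain ⟨B', hB'⟩ := exists_nat_ge (B - f x)
      refine ⟨B', fun k => ?_⟩
      have := hB (k + 1)
      rw [birkhoffSum_succ'] at this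
      linarith
  rcases hT.toPreErgodic.ae_mem_or_ae_notMem hUm hinv with h | h
  · exact h
  exfalso
  have hmono : Monotone fun n => {x | 0 < birkhoffMax T f n x} :=
    monotone_nat_of_le_succ fun n x hx => lt_of_lt_of_le hx (birkhoffMax_le_succ n x)
  have hlim := tendsto_setIntegral_of_monotone (μ := μ) (f := f)
    (fun n => measurableSet_lt measurable_const
      (measurable_birkhoffMax hT.toMeasurePreserving.measurable hfm n)) hmono hf.integrableOn
  have huniv : ∫ x in ⋃ n, {x | 0 < birkhoffMax T f n x}, f x ∂μ = ∫ x, f x ∂μ := by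
    refine setIntegral_eq_integral_of_ae_compl_eq_zero ?_
    filter_upwards [h] with x hx hx'
    exfalso
    refine hx ⟨0, fun k => ?_⟩
    have h1 : ¬ 0 < birkhoffMax T f k x := fun h => hx' (mem_iUnion.2 ⟨k, h⟩)
    have := birkhoffSum_le_birkhoffMax (T := T) (f := f) k x
    push_cast
    linarith
  rw [huniv] at hlim
  have := ge_of_tendsto' hlim fun n =>
    setIntegral_birkhoffMax_pos_nonneg hT.toMeasurePreserving hf hfm n
  linarith

/-- For `∫ f < c' < c` the sums of `f - c'` are bounded above, so the averages of `f` exceed `c'` by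
at most `B / k`. -/
lemma ae_eventually_birkhoffAverage_lt [IsProbabilityMeasure μ] (hT : Ergodic T μ)
    (hf : Integrable f μ) (hfm : Measurable f) {c : ℝ} (hc : ∫ x, f x ∂μ < c) :
    ∀ᵐ x ∂μ, ∀ᶠ k : ℕ in atTop, birkhoffAverage ℝ T f k x < c := by
  obtain ⟨c', h1, h2⟩ := exists_between hc
  have hneg : ∫ x, (f x - c') ∂μ < 0 := by
    rw [integral_sub hf (integrable_const _)]
    simpa using h1
  filter_upwards [ae_bddAbove_birkhoffSum hT (hf.sub (integrable_const c'))
    (hfm.sub measurable_const) hneg] with x hx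
  obtain ⟨B, hB⟩ := hx
  have hlim : Tendsto (fun k : ℕ => (B : ℝ) / k) atTop (𝓝 0) := tendsto_const_div_atTop_nhds_zero_nat _
  filter_upwards [hlim.eventually (gt_mem_nhds (sub_pos.2 h2)), eventually_gt_atTop 0] with k hk hk0
  have hk0' : (0 : ℝ) < k := by exact_mod_cast hk0
  have h3 : birkhoffSum T (fun x => f x - c') k x = birkhoffSum T f k x - k * c' := by
    simp [birkhoffSum, Finset.sum_sub_distrib]
  have h4 : birkhoffSum T f k x ≤ B + k * c' := by
    have h5 : birkhoffSum T (fun x => f x - c') k x ≤ B := hB k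
    linarith
  rw [birkhoffAverage, smul_eq_mul, inv_mul_lt_iff₀ hk0']
  rw [div_lt_iff₀ hk0'] at hk
  nlinarith

/-- Birkhoff's pointwise ergodic theorem for ergodic transformations. -/
theorem ae_tendsto_birkhoffAverage [IsProbabilityMeasure μ] (hT : Ergodic T μ)
    (hf : Integrable f μ) (hfm : Measurable f) :
    ∀ᵐ x ∂μ, Tendsto (fun k : ℕ => birkhoffAverage ℝ T f k x) atTop (𝓝 (∫ x, f x ∂μ)) := by
  have h1 : ∀ᵐ x ∂μ, ∀ j : ℕ, ∀ᶠ k : ℕ in atTop,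
      birkhoffAverage ℝ T f k x < ∫ x, f x ∂μ + 1 / ((j : ℝ) + 1) :=
    ae_all_iff.2 fun j => ae_eventually_birkhoffAverage_lt hT hf hfm
      (lt_add_of_pos_right _ Nat.one_div_pos_of_nat)
  have h2 : ∀ᵐ x ∂μ, ∀ j : ℕ, ∀ᶠ k : ℕ in atTop,
      birkhoffAverage ℝ T (-f) k x < -∫ x, f x ∂μ + 1 / ((j : ℝ) + 1) :=
    ae_all_iff.2 fun j => ae_eventually_birkhoffAverage_lt hT hf.neg hfm.neg (by
      simp only [Pi.neg_apply, integral_neg]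
      exact lt_add_of_pos_right _ Nat.one_div_pos_of_nat)
  filter_upwards [h1, h2] with x hx1 hx2
  rw [tendsto_order]
  constructor
  · intro c hc
    obtain ⟨j, hj⟩ := exists_nat_one_div_lt (sub_pos.2 hc)
    filter_upwards [hx2 j] with k hk
    have : birkhoffAverage ℝ T (-f) k x = - birkhoffAverage ℝ T f k x := by
      simp [birkhoffAverage, birkhoffSum]
    linarith
  · intro c hc
    obtain ⟨j, hj⟩ := exists_nat_one_div_lt (sub_pos.2 hc)
    filter_upwards [hx1 j] with k hk
    linarith

end Birkhoff

/-! ### From the ergodic group to its generator. -/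

/-- Invariance under `τ 1` propagates to every `τ k` by induction over `ℤ`; as `τ (-k)` inverts `τ
k`, invariance of preimages becomes the invariance of images required by the group hypothesis. -/
lemma IsErgodicGroup.ergodic_one {Ω : Type*} [MeasurableSpace Ω] {μ : Measure Ω}
    [IsProbabilityMeasure μ] {τ : ℤ → Ω → Ω} (hτ : IsErgodicGroup μ τ) : Ergodic (τ 1) μ where
  toMeasurePreserving := hτ.measurePreserving 1
  aeconst_set s hs hinv := by
    have hcomp : ∀ k k' ω, τ k (τ k' ω) = τ (k + k') ω := fun k k' ω => by
      rw [hτ.map_add]; rfl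
    have h0 : ∀ ω, τ 0 ω = ω := fun ω => by rw [hτ.map_zero]; rfl
    have h1 : ∀ ω, τ 1 ω ∈ s ↔ ω ∈ s := fun ω => by
      conv_rhs => rw [← hinv]
      rfl
    have hk : ∀ (k : ℤ) ω, τ k ω ∈ s ↔ ω ∈ s := by
      intro k
      induction k using Int.induction_on with
      | zero => intro ω; rw [h0]
      | succ i ih => intro ω; rw [add_comm, ← hcomp, h1, ih]
      | pred i ih =>
        intro ω
        rw [← h1, hcomp, show 1 + (-(i : ℤ) - 1) = -i by ring, ih]
    have himg : ∀ k : ℤ, τ k '' s = s := by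
      intro k
      ext ω
      constructor
      · rintro ⟨ω', h, rfl⟩
        exact (hk k ω').2 h
      · intro h
        refine ⟨τ (-k) ω, (hk _ _).2 h, ?_⟩
        rw [hcomp, add_neg_cancel, h0]
    rw [eventuallyConst_set]
    rcases hτ.ergodic s hs himg with h | h
    · left
      exact (prob_compl_eq_zero_iff hs).2 h
    · right
      exact measure_eq_zero_iff_ae_notMem.1 h

lemma IsErgodicGroup.iterate_one {Ω : Type*} [MeasurableSpace Ω] {μ : Measure Ω}
    {τ : ℤ → Ω → Ω} (hτ : IsErgodicGroup μ τ) (k : ℕ) (ω : Ω) : (τ 1)^[k] ω = τ k ω := by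
  induction k with
  | zero => simp [hτ.map_zero]
  | succ k ih =>
    rw [Function.iterate_succ_apply', ih, Nat.cast_succ, add_comm, hτ.map_add]
    rfl

/-! ### Paths under a speed limit: concatenation, straight lines, compactness. -/

section Paths

variable {E : Type*} [NormedAddCommGroup E]

/-- Path-wise form of the speed limit `‖γ'‖ ≤ b (γ, ·)` on `[s, t]`. -/
def ObeysSpeedLimit (b : E → ℝ → ℝ) (s t : ℝ) (γ : ℝ → E) : Prop :=
  ∀ u v M : ℝ, s ≤ u → u ≤ v → v ≤ t → (∀ r ∈ Icc u v, b (γ r) r ≤ M) →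
    ‖γ v - γ u‖ ≤ M * (v - u)

/-- `y` can be reached at time `t` from `x` at time `s`. -/
def Reach (b : E → ℝ → ℝ) (s t : ℝ) (x y : E) : Prop :=
  ∃ γ : ℝ → E, ObeysSpeedLimit b s t γ ∧ γ s = x ∧ γ t = y

variable {b : E → ℝ → ℝ} {s m t : ℝ} {x y z : E} {γ γ' : ℝ → E}

lemma ObeysSpeedLimit.congr (h : ObeysSpeedLimit b s t γ) (hγ : ∀ r ∈ Icc s t, γ r = γ' r) :
    ObeysSpeedLimit b s t γ' := by
  intro u v M hu huv hv hM
  rw [← hγ v ⟨hu.trans huv, hv⟩, ← hγ u ⟨hu, huv.trans hv⟩]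
  refine h u v M hu huv hv fun r hr => ?_
  rw [hγ r ⟨hu.trans hr.1, hr.2.trans hv⟩]
  exact hM r hr

lemma ObeysSpeedLimit.mono (h : ObeysSpeedLimit b s t γ) {s' t' : ℝ} (hs : s ≤ s') (ht : t' ≤ t) :
    ObeysSpeedLimit b s' t' γ :=
  fun u v M hu huv hv hM => h u v M (hs.trans hu) huv (hv.trans ht) hM

lemma ObeysSpeedLimit.norm_sub_le (h : ObeysSpeedLimit b s t γ) {β : ℝ} (hβ : ∀ x r, b x r ≤ β)
    {u v : ℝ} (hu : s ≤ u) (huv : u ≤ v) (hv : v ≤ t) : ‖γ v - γ u‖ ≤ β * (v - u) :=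
  h u v β hu huv hv fun _ _ => hβ _ _

lemma Reach.trans (h₁ : Reach b s m x y) (h₂ : Reach b m t y z) (hsm : s ≤ m) (hmt : m ≤ t) :
    Reach b s t x z := by
  obtain ⟨γ₁, hγ₁, h1s, h1m⟩ := h₁
  obtain ⟨γ₂, hγ₂, h2m, h2t⟩ := h₂
  have hle : ∀ r, r ≤ m → (if r ≤ m then γ₁ r else γ₂ r) = γ₁ r := fun r hr => if_pos hr
  have hge : ∀ r, m ≤ r → (if r ≤ m then γ₁ r else γ₂ r) = γ₂ r := fun r hr => by
    rcases hr.eq_or_lt with rfl | h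
    · rw [if_pos le_rfl, h1m, h2m]
    · exact if_neg h.not_ge
  refine ⟨fun r => if r ≤ m then γ₁ r else γ₂ r, ?_, (hle s hsm).trans h1s,
    (hge t hmt).trans h2t⟩
  have A := hγ₁.congr (γ' := fun r => if r ≤ m then γ₁ r else γ₂ r)
    fun r hr => (hle r hr.2).symm
  have B := hγ₂.congr (γ' := fun r => if r ≤ m then γ₁ r else γ₂ r)
    fun r hr => (hge r hr.1).symm
  generalize (fun r => if r ≤ m then γ₁ r else γ₂ r) = γ at A B
  intro u v M hu huv hv hM
  rcases le_total v m with hvm | hvm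
  · exact A u v M hu huv hvm hM
  rcases le_total m u with hum | hum
  · exact B u v M hum huv hv hM
  have h1 := A u m M hu hum le_rfl fun r hr => hM r ⟨hr.1, hr.2.trans hvm⟩
  have h2 := B m v M le_rfl hvm hv fun r hr => hM r ⟨hum.trans hr.1, hr.2⟩
  calc ‖γ v - γ u‖ ≤ ‖γ v - γ m‖ + ‖γ m - γ u‖ := norm_sub_le_norm_sub_add_norm_sub _ _ _
    _ ≤ M * (v - u) := by linarith

lemma Reach.exists_between (h : Reach b s t x z) (hsm : s ≤ m) (hmt : m ≤ t) :
    ∃ y, Reach b s m x y ∧ Reach b m t y z := by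
  obtain ⟨γ, hγ, h1, h2⟩ := h
  exact ⟨γ m, ⟨γ, hγ.mono le_rfl hmt, h1, rfl⟩, ⟨γ, hγ.mono hsm le_rfl, rfl, h2⟩⟩

lemma Reach.norm_sub_le (h : Reach b s t x y) {β : ℝ} (hβ : ∀ x r, b x r ≤ β) (hst : s ≤ t) :
    ‖y - x‖ ≤ β * (t - s) := by
  obtain ⟨γ, hγ, rfl, rfl⟩ := h
  exact hγ.norm_sub_le hβ le_rfl hst le_rfl

lemma Reach.add_right (h : Reach b s t x y) {l : E} (hl : ∀ x r, b (x + l) r = b x r) :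
    Reach b s t (x + l) (y + l) := by
  obtain ⟨γ, hγ, rfl, rfl⟩ := h
  refine ⟨fun r => γ r + l, ?_, rfl, rfl⟩
  intro u v M hu huv hv hM
  simp only [hl] at hM
  simpa using hγ u v M hu huv hv hM

lemma reach_comp_add_time (k : ℝ) :
    Reach (fun x r => b x (r + k)) s t x y ↔ Reach b (s + k) (t + k) x y := by
  constructor
  · rintro ⟨γ, hγ, rfl, rfl⟩
    refine ⟨fun r => γ (r - k), ?_, by simp, by simp⟩
    intro u v M hu huv hv hM
    have := hγ (u - k) (v - k) M (by linarith) (by linarith) (by linarith) fun r hr => by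
      have := hM (r + k) ⟨by linarith [hr.1], by linarith [hr.2]⟩
      simpa using this
    simpa using this
  · rintro ⟨γ, hγ, rfl, rfl⟩
    refine ⟨fun r => γ (r + k), ?_, rfl, rfl⟩
    intro u v M hu huv hv hM
    have := hγ (u + k) (v + k) M (by linarith) (by linarith) (by linarith) fun r hr => by
      have := hM (r - k) ⟨by linarith [hr.1], by linarith [hr.2]⟩
      simpa using this
    simpa using this

section Line

variable [NormedSpace ℝ E]

/-- The segment traversed at constant speed stays in the ball where `c ≤ b`, so every upper bound of
`b` along it is at least `c`. -/
lemma reach_of_norm_sub_le {c : ℝ} (hst : s ≤ t) (hxy : ‖y - x‖ ≤ c * (t - s))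
    (hc : ∀ z, ∀ r ∈ Icc s t, ‖z - x‖ ≤ ‖y - x‖ → c ≤ b z r) : Reach b s t x y := by
  rcases hst.eq_or_lt with rfl | hlt
  · have : y = x := by simpa [sub_eq_zero] using hxy
    subst this
    refine ⟨fun _ => y, ?_, rfl, rfl⟩
    intro u v M hu huv hv hM
    have : v = u := by linarith
    simp [this]
  have hpos : 0 < t - s := sub_pos.2 hlt
  refine ⟨fun r => x + ((r - s) / (t - s)) • (y - x), ?_, by simp, by simp [div_self hpos.ne']⟩
  intro u v M hu huv hv hM
  have hcM : c ≤ M := by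
    refine (hc _ u ⟨hu, huv.trans hv⟩ ?_).trans (hM u ⟨le_rfl, huv⟩)
    rw [add_sub_cancel_left, norm_smul, Real.norm_of_nonneg (div_nonneg (by linarith) hpos.le)]
    exact mul_le_of_le_one_left (norm_nonneg _) ((div_le_one hpos).2 (by linarith))
  have h1 : (x + ((v - s) / (t - s)) • (y - x)) - (x + ((u - s) / (t - s)) • (y - x))
      = ((v - u) / (t - s)) • (y - x) := by
    rw [add_sub_add_left_eq_sub, ← sub_smul]
    congr 1
    ring
  rw [h1, norm_smul, Real.norm_of_nonneg (div_nonneg (by linarith) hpos.le)]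
  calc (v - u) / (t - s) * ‖y - x‖ ≤ (v - u) / (t - s) * (c * (t - s)) := by
        gcongr
    _ = c * (v - u) := by field_simp
    _ ≤ M * (v - u) := by
        gcongr

lemma reach_of_norm_sub_le_of_le {α : ℝ} (hα : ∀ x r, α ≤ b x r) (hst : s ≤ t)
    (hxy : ‖y - x‖ ≤ α * (t - s)) : Reach b s t x y :=
  reach_of_norm_sub_le hst hxy fun _ _ _ _ => hα _ _

lemma reach_self {α : ℝ} (hα0 : 0 ≤ α) (hα : ∀ x r, α ≤ b x r) (hst : s ≤ t) : Reach b s t x x :=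
  reach_of_norm_sub_le_of_le hα hst (by simpa using mul_nonneg hα0 (sub_nonneg.2 hst))

end Line

lemma LipschitzWith.abs_sub_le_add {K : ℝ≥0} (hK : LipschitzWith K fun p : E × ℝ => b p.1 p.2)
    (x y : E) (r q : ℝ) : |b x r - b y q| ≤ K * (‖x - y‖ + |r - q|) := by
  have := hK.dist_le_mul (x, r) (y, q)
  rw [Prod.dist_eq, Real.dist_eq, dist_eq_norm, Real.dist_eq] at this
  refine this.trans (mul_le_mul_of_nonneg_left ?_ K.2)
  exact max_le (le_add_of_nonneg_right (abs_nonneg _)) (le_add_of_nonneg_left (norm_nonneg _))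

/-- During `[u, v]` the path moves by at most `β * (v - u)`, so `b` varies along it by at most `K *
(β + 1) * (v - u)`. -/
lemma ObeysSpeedLimit.norm_sub_le_add_sq {K : ℝ≥0} {β : ℝ}
    (hK : LipschitzWith K fun p : E × ℝ => b p.1 p.2) (hβ0 : 0 ≤ β) (hβ : ∀ x r, b x r ≤ β)
    (h : ObeysSpeedLimit b s t γ) {u v : ℝ} (hu : s ≤ u) (huv : u ≤ v) (hv : v ≤ t) :
    ‖γ v - γ u‖ ≤ (b (γ u) u + K * (β + 1) * (v - u)) * (v - u) := by
  refine h u v _ hu huv hv fun r hr => ?_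
  have h1 := (abs_le.1 (hK.abs_sub_le_add (γ r) (γ u) r u)).2
  have h2 := h.norm_sub_le hβ hu hr.1 (hr.2.trans hv)
  rw [abs_of_nonneg (sub_nonneg.2 hr.1)] at h1
  have h3 : (K : ℝ) * (‖γ r - γ u‖ + (r - u)) ≤ K * ((β + 1) * (v - u)) := by
    refine mul_le_mul_of_nonneg_left ?_ K.2
    nlinarith [hr.2, hr.1]
  nlinarith

/-- Over `N + 1` equal pieces of `[u, v]` the quadratic errors add up to `L * (v - u) ^ 2 / (N +
1)`, which tends to `0`. This two-point form of the speed limit passes to pointwise limits. -/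
lemma obeysSpeedLimit_of_norm_sub_le_add_sq {L : ℝ}
    (h : ∀ u v, s ≤ u → u ≤ v → v ≤ t → ‖γ v - γ u‖ ≤ (b (γ u) u + L * (v - u)) * (v - u)) :
    ObeysSpeedLimit b s t γ := by
  intro u v M hu huv hv hM
  have key : ∀ N : ℕ, ‖γ v - γ u‖ ≤ (M + L * ((v - u) / (N + 1))) * (v - u) := by
    intro N
    set d := (v - u) / (N + 1) with hd
    have hd0 : 0 ≤ d := div_nonneg (sub_nonneg.2 huv) (by positivity)
    have hNd : ((N : ℝ) + 1) * d = v - u := by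
      rw [hd]
      field_simp
    have step : ∀ i : ℕ, i ≤ N + 1 → ‖γ (u + i * d) - γ u‖ ≤ i * ((M + L * d) * d) := by
      intro i
      induction i with
      | zero => simp
      | succ i ih =>
        intro hi
        have h1 := ih (by omega)
        have hi' : (i : ℝ) + 1 ≤ N + 1 := by exact_mod_cast hi
        have hid : 0 ≤ i * d := by positivity
        have hend : u + (i + 1) * d ≤ v := by nlinarith
        have h2 := h (u + i * d) (u + (i + 1) * d) (by linarith) (by linarith) (hend.trans hv)
        have h3 := hM (u + i * d) ⟨by linarith, by linarith⟩
        have h4 : u + (i + 1) * d - (u + i * d) = d := by ring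
        rw [h4] at h2
        push_cast
        calc ‖γ (u + (i + 1) * d) - γ u‖
            ≤ ‖γ (u + (i + 1) * d) - γ (u + i * d)‖ + ‖γ (u + i * d) - γ u‖ :=
              norm_sub_le_norm_sub_add_norm_sub _ _ _
          _ ≤ (b (γ (u + i * d)) (u + i * d) + L * d) * d + i * ((M + L * d) * d) := add_le_add h2 h1
          _ ≤ (M + L * d) * d + i * ((M + L * d) * d) := by gcongr
          _ = (i + 1) * ((M + L * d) * d) := by ring
    have := step (N + 1) le_rfl
    push_cast at this
    rw [hNd, add_sub_cancel] at this
    calc _ ≤ _ := this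
      _ = (M + L * d) * (((N : ℝ) + 1) * d) := by ring
      _ = _ := by rw [hNd]
  have hlim : Tendsto (fun N : ℕ => (M + L * ((v - u) / ((N : ℝ) + 1))) * (v - u)) atTop
      (𝓝 ((M + L * 0) * (v - u))) :=
    ((tendsto_const_div_atTop_nhds_zero_nat (v - u)).comp (tendsto_add_atTop_nat 1)
      |>.congr (fun N => by simp) |>.const_mul L |>.const_add M).mul_const _
  simpa using ge_of_tendsto' hlim key

/-- The two-point form involves only evaluations of `γ`, hence is closed in the product topology;
Tychonoff's theorem then gives a compact set of paths, whose evaluation at `t` is the reachable set.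
-/
lemma isCompact_setOf_reach [ProperSpace E] {K : ℝ≥0} {β : ℝ}
    (hK : LipschitzWith K fun p : E × ℝ => b p.1 p.2) (hβ0 : 0 ≤ β) (hβ : ∀ x r, b x r ≤ β)
    (hst : s ≤ t) {Y : Set E} (hY : IsCompact Y) : IsCompact {y | ∃ x ∈ Y, Reach b s t x y} := by
  obtain ⟨R, hR⟩ := hY.isBounded.exists_norm_le
  set R' := R + β * (t - s)
  set L := (K : ℝ) * (β + 1)
  let P : Set (ℝ → E) := univ.pi fun _ => Metric.closedBall (0 : E) R'
  have hP : IsCompact P := isCompact_univ_pi fun _ => isCompact_closedBall _ _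
  let S : Set (ℝ → E) := {γ | γ s ∈ Y ∧ ∀ u v, s ≤ u → u ≤ v → v ≤ t →
    ‖γ v - γ u‖ ≤ (b (γ u) u + L * (v - u)) * (v - u)}
  have hS : IsClosed S := by
    refine IsClosed.and (hY.isClosed.preimage (continuous_apply s)) ?_
    simp only [ofPred_forall]
    refine isClosed_iInter fun u => isClosed_iInter fun v => isClosed_iInter fun _ =>
      isClosed_iInter fun _ => isClosed_iInter fun _ => ?_
    have h1 : Continuous fun γ : ℝ → E => b (γ u) u :=
      hK.continuous.comp (f := fun γ : ℝ → E => (γ u, u)) ((continuous_apply u).prodMk continuous_const)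
    exact isClosed_le ((continuous_apply v).sub (continuous_apply u)).norm
      ((h1.add continuous_const).mul continuous_const)
  convert (hP.inter_right hS).image (continuous_apply t) using 1
  ext y
  constructor
  · rintro ⟨x, hx, γ, hγ, hs, ht⟩
    -- Clamping time to `[s, t]` keeps the path in the ball at all real times, as membership in `P`
    -- demands.
    have hcl : ∀ r ∈ Icc s t, γ r = γ (max s (min r t)) := fun r hr => by
      rw [min_eq_left hr.2, max_eq_right hr.1]
    refine ⟨fun r => γ (max s (min r t)), ⟨?_, ?_, ?_⟩, ?_⟩
    · intro r _
      have h1 := hγ.norm_sub_le hβ le_rfl (le_max_left s (min r t)) (max_le hst (min_le_right _ _))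
      have h2 := hR x hx
      rw [hs] at h1
      have h3 : max s (min r t) ≤ t := max_le hst (min_le_right _ _)
      rw [mem_closedBall_zero_iff]
      calc ‖γ (max s (min r t))‖ ≤ ‖x‖ + ‖γ (max s (min r t)) - x‖ := by
            simpa using norm_add_le x (γ (max s (min r t)) - x)
        _ ≤ R + β * (t - s) := by
            gcongr
            exact h1.trans (by gcongr)
    · simp only [← hcl s ⟨le_rfl, hst⟩, hs]
      exact hx
    · intro u v hu huv hv
      exact (hγ.congr hcl).norm_sub_le_add_sq hK hβ0 hβ hu huv hv
    · simp only [← hcl t ⟨hst, le_rfl⟩, ht]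
  · rintro ⟨γ, ⟨-, h1, h2⟩, rfl⟩
    exact ⟨γ s, h1, γ, obeysSpeedLimit_of_norm_sub_le_add_sq h2, rfl, rfl⟩

end Paths

/-! ### Absolutely continuous paths versus the speed limit. -/

section Admissible

variable {n : ℕ} {Ω : Type*} {a : EuclideanSpace ℝ (Fin n) → ℝ → Ω → ℝ} {ω : Ω} {s t : ℝ}
  {γ : ℝ → EuclideanSpace ℝ (Fin n)}

lemma AbsolutelyContinuousOnInterval.inner_const {E : Type*} [NormedAddCommGroup E]
    [InnerProductSpace ℝ E] {γ : ℝ → E} (h : AbsolutelyContinuousOnInterval γ s t) (w : E) :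
    AbsolutelyContinuousOnInterval (fun r => inner ℝ w (γ r)) s t := by
  have h1 : Tendsto _ _ _ := h
  have h2 := h1.const_mul ‖w‖
  rw [mul_zero] at h2
  refine squeeze_zero (fun I => Finset.sum_nonneg fun i _ => dist_nonneg) (fun I => ?_) h2
  rw [Finset.mul_sum]
  refine Finset.sum_le_sum fun i _ => ?_
  rw [Real.dist_eq, ← inner_sub_right, dist_eq_norm]
  exact abs_real_inner_le_norm _ _

/-- Integrating the derivative of `⟪w, γ⟫`, with `w` the increment itself, gives `‖w‖ ^ 2 ≤ ‖w‖ * M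
* (v - u)`. -/
lemma obeysSpeedLimit_of_mem_admissiblePaths (h : γ ∈ admissiblePaths a s t ω) :
    ObeysSpeedLimit (fun x r => a x r ω) s t γ := by
  obtain ⟨hac, hae⟩ := h
  intro u v M hu huv hv hM
  have hst : s ≤ t := hu.trans (huv.trans hv)
  set w := γ v - γ u with hw
  have hac' := (hac.mono (c := u) (d := v) (by
    rw [uIcc_of_le huv, uIcc_of_le hst]
    exact Icc_subset_Icc hu hv)).inner_const w
  have h1 := hac'.integral_deriv_eq_sub
  have h2 : ∫ r in u..v, deriv (fun r => inner ℝ w (γ r)) r ≤ ∫ _ in u..v, ‖w‖ * M := by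
    refine intervalIntegral.integral_mono_ae_restrict huv hac'.intervalIntegrable_deriv
      intervalIntegrable_const ?_
    have hae' := ae_restrict_of_ae_restrict_of_subset (Icc_subset_Icc hu hv) hae
    filter_upwards [hae', ae_restrict_mem measurableSet_Icc] with r hr hr'
    have h3 : HasDerivAt (fun r => inner ℝ w (γ r)) (inner ℝ w (deriv γ r)) r := by
      simpa using (hasDerivAt_const r w).inner ℝ hr.1.hasDerivAt
    rw [h3.deriv]
    refine (real_inner_le_norm _ _).trans (mul_le_mul_of_nonneg_left ?_ (norm_nonneg _))
    exact hr.2.trans (hM r hr')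
  rw [h1, ← inner_sub_right, ← hw, real_inner_self_eq_norm_sq, intervalIntegral.integral_const,
    smul_eq_mul] at h2
  rcases (norm_nonneg w).eq_or_lt with h0 | h0
  -- When `w = 0` the sign of `M` is needed; it comes from a single time at which `0 ≤ ‖γ'‖ ≤ a ≤
  -- M`.
  · have hM' : 0 ≤ M * (v - u) := by
      rcases huv.eq_or_lt with rfl | hlt
      · simp
      have hne : (volume.restrict (Icc u v)) ≠ 0 := by
        rw [Ne, Measure.restrict_eq_zero, Real.volume_Icc]
        simpa using hlt
      have hae' := ae_restrict_of_ae_restrict_of_subset (Icc_subset_Icc hu hv) hae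
      have : (ae (volume.restrict (Icc u v))).NeBot := ae_neBot.2 hne
      obtain ⟨r, hr, hr'⟩ := (hae'.and (ae_restrict_mem measurableSet_Icc)).exists
      exact mul_nonneg (((norm_nonneg _).trans hr.2).trans (hM r hr')) (sub_nonneg.2 huv)
    rwa [← h0]
  · nlinarith

/-- Conversely, a path obeying the speed limit is `β`-Lipschitz, hence absolutely continuous and
almost everywhere differentiable; letting `v ↓ r` in the two-point form bounds its derivative. -/
lemma mem_reachableSet_iff {K : ℝ≥0} {β : ℝ}
    (hK : LipschitzWith K fun p : EuclideanSpace ℝ (Fin n) × ℝ => a p.1 p.2 ω) (hβ0 : 0 ≤ β)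
    (hβ : ∀ x r, a x r ω ≤ β) (hst : s ≤ t) {x y : EuclideanSpace ℝ (Fin n)} :
    y ∈ reachableSet a t x s ω ↔ Reach (fun x r => a x r ω) s t x y := by
  constructor
  · rintro ⟨γ, hγ, h1, h2⟩
    exact ⟨γ, obeysSpeedLimit_of_mem_admissiblePaths hγ, h1, h2⟩
  rintro ⟨γ₀, hγ₀, h1, h2⟩
  -- Values outside `[s, t]` are arbitrary; clamping makes the path Lipschitz on all of `ℝ`.
  set c : ℝ → ℝ := fun r => max s (min r t) with hc
  have hcl : ∀ r ∈ Icc s t, c r = r := fun r hr => by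
    rw [hc]
    simp only [min_eq_left hr.2, max_eq_right hr.1]
  have hcm : ∀ r, c r ∈ Icc s t := fun r => ⟨le_max_left _ _, max_le hst (min_le_right _ _)⟩
  have hγ : ObeysSpeedLimit (fun x r => a x r ω) s t (γ₀ ∘ c) :=
    hγ₀.congr fun r hr => by rw [Function.comp, hcl r hr]
  have hlip : LipschitzWith (Real.toNNReal β) (γ₀ ∘ c) := by
    have hmono : ∀ u v, u ≤ v → dist ((γ₀ ∘ c) u) ((γ₀ ∘ c) v) ≤ β * dist u v := by
      intro u v huv
      have hcuv : c u ≤ c v := max_le_max le_rfl (min_le_min huv le_rfl)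
      have h3 := hγ₀.norm_sub_le hβ (hcm u).1 hcuv (hcm v).2
      have h4 : c v - c u ≤ v - u := by
        simp only [hc]
        rcases le_total v t with h | h <;> rcases le_total u t with h' | h' <;>
          simp only [min_eq_left, min_eq_right, h, h'] <;>
          rcases le_total s v with h'' | h'' <;> rcases le_total s u with h''' | h''' <;>
          simp only [max_eq_left, max_eq_right, h'', h''', hst] <;> linarith
      rw [dist_comm, dist_eq_norm, dist_comm, Real.dist_eq, abs_of_nonneg (sub_nonneg.2 huv)]
      exact h3.trans (by gcongr)
    refine LipschitzWith.of_dist_le_mul fun u v => ?_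
    rw [Real.coe_toNNReal β hβ0]
    rcases le_total u v with h | h
    · exact hmono u v h
    · rw [dist_comm, dist_comm u v]
      exact hmono v u h
  refine ⟨γ₀ ∘ c, ⟨(hlip.lipschitzOnWith (s := uIcc s t)).absolutelyContinuousOnInterval, ?_⟩,
    by rw [Function.comp, hcl s ⟨le_rfl, hst⟩, h1], by rw [Function.comp, hcl t ⟨hst, le_rfl⟩, h2]⟩
  rw [Measure.restrict_congr_set Ioo_ae_eq_Icc.symm]
  filter_upwards [ae_restrict_of_ae hlip.ae_differentiableAt_real,
    ae_restrict_mem measurableSet_Ioo] with r hr hr'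
  refine ⟨hr, ?_⟩
  have h3 := (hr.hasDerivAt.hasDerivWithinAt (s := Ioi r))
  rw [hasDerivWithinAt_iff_tendsto_slope' (by simp)] at h3
  have h4 : Tendsto (fun v : ℝ => a ((γ₀ ∘ c) r) r ω + K * (β + 1) * (v - r)) (𝓝[>] r)
      (𝓝 (a ((γ₀ ∘ c) r) r ω + K * (β + 1) * (r - r))) := by
    refine Tendsto.mono_left (Continuous.tendsto ?_ r) nhdsWithin_le_nhds
    fun_prop
  rw [sub_self, mul_zero, add_zero] at h4
  refine le_of_tendsto_of_tendsto h3.norm h4 ?_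
  filter_upwards [Ioo_mem_nhdsGT hr'.2] with v hv
  have h5 := hγ.norm_sub_le_add_sq hK hβ0 hβ hr'.1.le hv.1.le hv.2.le
  have h6 : 0 < v - r := sub_pos.2 hv.1
  rw [slope_def_module, norm_smul, norm_inv, Real.norm_of_nonneg h6.le, inv_mul_le_iff₀ h6, mul_comm]
  exact h5

end Admissible

/-! ### Comparing displacements from different starting points. -/

section Lattice

variable {n : ℕ} {b : EuclideanSpace ℝ (Fin n) → ℝ → ℝ} {α β κ T s t : ℝ}

lemma exists_norm_sub_latticePoint_le (v : EuclideanSpace ℝ (Fin n)) :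
    ∃ l : Fin n → ℤ, ‖v - latticePoint l‖ ≤ √n := by
  refine ⟨fun i => ⌊v i⌋, ?_⟩
  rw [EuclideanSpace.norm_eq]
  refine Real.sqrt_le_sqrt ?_
  calc ∑ i, ‖(v - latticePoint fun i => ⌊v i⌋) i‖ ^ 2 ≤ ∑ _i : Fin n, (1 : ℝ) := by
        refine Finset.sum_le_sum fun i _ => ?_
        have h1 : (v - latticePoint fun i => ⌊v i⌋) i = Int.fract (v i) := rfl
        rw [h1, Real.norm_of_nonneg (Int.fract_nonneg _)]
        exact pow_le_one₀ (Int.fract_nonneg _) (Int.fract_lt_one _).le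
    _ = n := by simp

lemma latticePoint_neg (l : Fin n → ℤ) : latticePoint (-l) = -latticePoint l := by
  ext i
  simp [latticePoint]

/-- After an initial waiting time `T`, displacements that are possible from one starting point are
possible, up to a bounded error, from every other one. -/
lemma Reach.exists_near_displacement {x y : EuclideanSpace ℝ (Fin n)} (h : Reach b s t x y)
    (hα : ∀ x r, α ≤ b x r) (hβ : ∀ x r, b x r ≤ β)
    (hper : ∀ (l : Fin n → ℤ) x r, b (x + latticePoint l) r = b x r)
    (hT0 : 0 ≤ T) (hT : √n ≤ α * T) (hst : s + T ≤ t) (x' : EuclideanSpace ℝ (Fin n)) :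
    ∃ y', Reach b s t x' y' ∧ ‖(y' - x') - (y - x)‖ ≤ β * T + √n := by
  obtain ⟨q, hxq, hqy⟩ := h.exists_between (m := s + T) (by linarith) hst
  -- The translate `q - l` is within `√n ≤ α * T` of `x'`, so it can be reached by time `s + T`;
  -- from there the translated path is followed. Only the displacements up to time `s + T` differ,
  -- of sizes at most `√n` and `β * T`.
  obtain ⟨l, hl⟩ := exists_norm_sub_latticePoint_le (q - x')
  refine ⟨y + latticePoint (-l), ?_, ?_⟩
  · refine Reach.trans (m := s + T) ?_ (hqy.add_right (hper (-l))) (by linarith) hst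
    refine reach_of_norm_sub_le_of_le hα (by linarith) ?_
    have h1 : q + latticePoint (-l) - x' = q - x' - latticePoint l := by
      rw [latticePoint_neg]
      abel
    rw [h1, add_sub_cancel_left]
    exact hl.trans hT
  · have h1 : (y + latticePoint (-l) - x') - (y - x)
        = (q - x' - latticePoint l) - (q - x) := by
      rw [latticePoint_neg]
      abel
    have h2 := hxq.norm_sub_le hβ (by linarith)
    rw [add_sub_cancel_left] at h2
    rw [h1]
    exact (_root_.norm_sub_le _ _).trans (by linarith)

end Lattice

/-! ### Countable discretisation of the paths. -/

section Chains

variable {E : Type*} [NormedAddCommGroup E] {Q : Set E} {b : E → ℝ → ℝ} {K : ℝ≥0} {L δ α β t : ℝ}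

/-- Discretisation of the reachable set: chains of points of `Q`, starting at `0`, one for each
time step of length `δ`. -/
def ChainReach (Q : Set E) (b : E → ℝ → ℝ) (L δ : ℝ) : ℕ → E → Prop
  | 0, z => z = 0
  | i + 1, z' => ∃ z ∈ Q, ChainReach Q b L δ i z ∧ ‖z' - z‖ ≤ δ * (b z (i * δ) - L * δ)

variable [NormedSpace ℝ E]

/-- Within one time step and a segment of length at most `δ * β`, `b` drops by at most `K * (β + 1)
* δ ≤ L * δ`. The reduction by `L * δ` in a link pays for this, so each link is a genuine straight
path. -/
lemma ChainReach.reach (hK : LipschitzWith K fun p : E × ℝ => b p.1 p.2) (hβ : ∀ x r, b x r ≤ β)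
    (hβ0 : 0 ≤ β) (hL : K * (β + 1) ≤ L) (hδ : 0 ≤ δ) {i : ℕ} {z : E}
    (h : ChainReach Q b L δ i z) : Reach b 0 (i * δ) 0 z := by
  induction i generalizing z with
  | zero =>
    have h : z = 0 := h
    subst h
    refine ⟨fun _ => 0, ?_, rfl, rfl⟩
    intro u v M hu huv hv _
    have : v = u := by simp at hv; linarith
    simp [this]
  | succ i ih =>
    obtain ⟨z', -, hz', hzz'⟩ := h
    have hL0 : 0 ≤ L := le_trans (by positivity) hL
    push_cast
    refine (ih hz').trans ?_ (by positivity) (by nlinarith)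
    refine reach_of_norm_sub_le (c := b z' (i * δ) - L * δ) (by nlinarith) ?_ ?_
    · refine hzz'.trans (le_of_eq ?_)
      ring
    · intro w r hr hw
      have h1 := (abs_le.1 (hK.abs_sub_le_add w z' r (i * δ))).1
      have h2 : |r - i * δ| ≤ δ := by
        rw [abs_of_nonneg (sub_nonneg.2 hr.1)]
        linarith [hr.2]
      have h3 : ‖w - z'‖ ≤ δ * β := by
        refine (hw.trans hzz').trans (mul_le_mul_of_nonneg_left ?_ hδ)
        nlinarith [hβ z' (i * δ)]
      have h4 : (K : ℝ) * (‖w - z'‖ + |r - i * δ|) ≤ K * (δ * β + δ) :=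
        mul_le_mul_of_nonneg_left (add_le_add h3 h2) K.2
      nlinarith

lemma exists_norm_le_norm_sub_le (v : E) {r : ℝ} (hr : 0 ≤ r) :
    ∃ w : E, ‖w‖ ≤ r ∧ ‖v - w‖ ≤ max 0 (‖v‖ - r) := by
  rcases le_total ‖v‖ r with h | h
  · exact ⟨v, h, by simp⟩
  rcases hr.eq_or_lt with rfl | hr
  · exact ⟨0, by simp, by simp⟩
  have hv : 0 < ‖v‖ := hr.trans_le h
  refine ⟨(r / ‖v‖) • v, ?_, ?_⟩
  · rw [norm_smul, Real.norm_of_nonneg (by positivity), div_mul_cancel₀ _ hv.ne']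
  · have h1 : v - (r / ‖v‖) • v = (1 - r / ‖v‖) • v := by rw [sub_smul, one_smul]
    rw [h1, norm_smul, Real.norm_of_nonneg (sub_nonneg.2 ((div_le_one hv).2 h)), sub_mul, one_mul,
      div_mul_cancel₀ _ hv.ne']
    exact le_max_right _ _

/-- A discrete Gronwall argument: following the increments of `γ`, truncated to the allowed length,
gives errors with `e (i + 1) ≤ (1 + δ * K) * e i + (2 * L + 2) * δ ^ 2`. -/
lemma ObeysSpeedLimit.exists_chainReach_near {γ : ℝ → E} (h : ObeysSpeedLimit b 0 t γ)
    (h0 : γ 0 = 0) (hQ : Dense Q) (hQ0 : (0 : E) ∈ Q)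
    (hK : LipschitzWith K fun p : E × ℝ => b p.1 p.2)
    (hα : ∀ x r, α ≤ b x r) (hβ : ∀ x r, b x r ≤ β) (hβ0 : 0 ≤ β) (hL : L = K * (β + 1))
    (hδ : 0 < δ) (hδα : (L + 1) * δ ≤ α) (i : ℕ) (hi : i * δ ≤ t) :
    ∃ z ∈ Q, ChainReach Q b L δ i z ∧
      ‖z - γ (i * δ)‖ ≤ (2 * L + 2) * δ ^ 2 * i * (1 + δ * K) ^ i := by
  have hL0 : 0 ≤ L := by rw [hL]; positivity
  induction i with
  | zero => exact ⟨0, hQ0, rfl, by simp [h0]⟩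
  | succ i ih =>
    push_cast at hi ⊢
    obtain ⟨z, hzQ, hz, he⟩ := ih (by nlinarith)
    set g := γ (i * δ) with hg
    have hv := h.norm_sub_le_add_sq hK hβ0 hβ (u := i * δ) (v := (i + 1) * δ) (by positivity)
      (by nlinarith) hi
    rw [← hg, ← hL, show ((i : ℝ) + 1) * δ - i * δ = δ by ring] at hv
    set v := γ ((i + 1) * δ) - g with hvdef
    -- The spare `δ ^ 2` leaves room to move the endpoint into the dense set `Q`.
    set r := δ * (b z (i * δ) - L * δ) - δ ^ 2 with hr
    have hr0 : 0 ≤ r := by nlinarith [hα z (i * δ)]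
    obtain ⟨w, hw, hvw⟩ := exists_norm_le_norm_sub_le v hr0
    obtain ⟨z', hz'Q, hz'⟩ := hQ.exists_dist_lt (z + w) (pow_pos hδ 2)
    rw [dist_eq_norm] at hz'
    refine ⟨z', hz'Q, ⟨z, hzQ, hz, ?_⟩, ?_⟩
    · calc ‖z' - z‖ = ‖w - (z + w - z')‖ := by congr 1; abel
        _ ≤ ‖w‖ + ‖z + w - z'‖ := _root_.norm_sub_le _ _
        _ ≤ δ * (b z (i * δ) - L * δ) := by linarith
    · have h1 := (abs_le.1 (hK.abs_sub_le_add g z (i * δ) (i * δ))).2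
      rw [sub_self, abs_zero, add_zero, norm_sub_rev] at h1
      have h2 : ‖v - w‖ ≤ δ * (K * ‖z - g‖) + (2 * L + 1) * δ ^ 2 := by
        refine hvw.trans (max_le (by positivity) ?_)
        nlinarith
      have h3 : ‖z' - γ ((i + 1) * δ)‖ ≤ ‖z - g‖ + ‖v - w‖ + δ ^ 2 := by
        calc ‖z' - γ ((i + 1) * δ)‖ = ‖(z - g) - (v - w) - (z + w - z')‖ := by
              rw [hvdef]; congr 1; abel
          _ ≤ ‖z - g‖ + ‖v - w‖ + ‖z + w - z'‖ :=
              (_root_.norm_sub_le _ _).trans (add_le_add (_root_.norm_sub_le _ _) le_rfl)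
          _ ≤ _ := by linarith
      have h4 : (1 : ℝ) ≤ (1 + δ * K) ^ (i + 1) :=
        one_le_pow₀ (by have : 0 ≤ δ * K := by positivity
                        linarith)
      have h5 : (1 + δ * K) * ‖z - g‖
          ≤ (1 + δ * K) * ((2 * L + 2) * δ ^ 2 * i * (1 + δ * K) ^ i) := by gcongr
      have h6 : (2 * L + 2) * δ ^ 2 * 1 ≤ (2 * L + 2) * δ ^ 2 * (1 + δ * K) ^ (i + 1) := by gcongr
      calc _ ≤ (1 + δ * K) * ‖z - g‖ + (2 * L + 2) * δ ^ 2 * 1 := by linarith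
        _ ≤ (1 + δ * K) * ((2 * L + 2) * δ ^ 2 * i * (1 + δ * K) ^ i)
            + (2 * L + 2) * δ ^ 2 * (1 + δ * K) ^ (i + 1) := add_le_add h5 h6
        _ = _ := by ring

lemma Reach.exists_chainReach_near {y : E} (h : Reach b 0 t 0 y) (ht : 0 < t)
    (hQ : Dense Q) (hQ0 : (0 : E) ∈ Q)
    (hK : LipschitzWith K fun p : E × ℝ => b p.1 p.2) (hα0 : 0 < α)
    (hα : ∀ x r, α ≤ b x r) (hβ : ∀ x r, b x r ≤ β) (hβ0 : 0 ≤ β) (hL : L = K * (β + 1))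
    {ε : ℝ} (hε : 0 < ε) :
    ∃ m : ℕ, ∃ z ∈ Q, ChainReach Q b L (t / (m + 1)) (m + 1) z ∧ ‖z - y‖ < ε := by
  have hL0 : 0 ≤ L := by rw [hL]; positivity
  obtain ⟨γ, hγ, h0, rfl⟩ := h
  have hδ : Tendsto (fun m : ℕ => t / ((m : ℝ) + 1)) atTop (𝓝 0) :=
    ((tendsto_const_div_atTop_nhds_zero_nat t).comp (tendsto_add_atTop_nat 1)).congr
      fun N => by simp
  have h1 : Tendsto (fun m : ℕ => (L + 1) * (t / ((m : ℝ) + 1))) atTop (𝓝 0) := by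
    simpa using hδ.const_mul (L + 1)
  have h2 : Tendsto (fun m : ℕ => (2 * L + 2) * t * Real.exp (t * K) * (t / ((m : ℝ) + 1)))
      atTop (𝓝 0) := by
    simpa using hδ.const_mul ((2 * L + 2) * t * Real.exp (t * K))
  obtain ⟨m, hm1, hm2⟩ :=
    ((h1.eventually (ge_mem_nhds hα0)).and (h2.eventually (gt_mem_nhds hε))).exists
  have hm : (0 : ℝ) < (m : ℝ) + 1 := by positivity
  have hmt : ((m + 1 : ℕ) : ℝ) * (t / (m + 1)) = t := by
    push_cast
    field_simp
  obtain ⟨z, hzQ, hz, he⟩ := hγ.exists_chainReach_near h0 hQ hQ0 hK hα hβ hβ0 hL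
    (div_pos ht hm) hm1 (m + 1) hmt.le
  refine ⟨m, z, hzQ, hz, ?_⟩
  rw [hmt] at he
  refine he.trans_lt (lt_of_le_of_lt ?_ hm2)
  have h3 : (1 + t / (m + 1) * K) ^ (m + 1) ≤ Real.exp (t * K) := by
    calc (1 + t / (m + 1) * K) ^ (m + 1) ≤ (Real.exp (t / (m + 1) * K)) ^ (m + 1) := by
          gcongr
          linarith [Real.add_one_le_exp (t / (m + 1) * (K : ℝ))]
      _ = Real.exp (t * K) := by
          rw [← Real.exp_nat_mul, ← mul_assoc, hmt]
  calc (2 * L + 2) * (t / (m + 1)) ^ 2 * (m + 1 : ℕ) * (1 + t / (m + 1) * K) ^ (m + 1)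
      ≤ (2 * L + 2) * (t / (m + 1)) ^ 2 * (m + 1 : ℕ) * Real.exp (t * K) := by gcongr
    _ = (2 * L + 2) * (((m + 1 : ℕ) : ℝ) * (t / (m + 1))) * Real.exp (t * K) * (t / (m + 1)) := by
        ring
    _ = _ := by rw [hmt]

end Chains

/-! ### One-sided set distance and support functions. -/

section Support

variable {E : Type*} [NormedAddCommGroup E]

/-- `A` is contained in the closed `C`-neighbourhood of `B`, with attained distances. -/
def NearSubset (C : ℝ) (A B : Set E) : Prop := ∀ x ∈ A, ∃ y ∈ B, ‖x - y‖ ≤ C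

lemma NearSubset.trans {C C' : ℝ} {A B D : Set E} (h : NearSubset C A B) (h' : NearSubset C' B D) :
    NearSubset (C + C') A D := by
  intro x hx
  obtain ⟨y, hy, hxy⟩ := h x hx
  obtain ⟨z, hz, hyz⟩ := h' y hy
  exact ⟨z, hz, (norm_sub_le_norm_sub_add_norm_sub x y z).trans (add_le_add hxy hyz)⟩

lemma NearSubset.mono {C C' : ℝ} {A B : Set E} (h : NearSubset C A B) (hC : C ≤ C') :
    NearSubset C' A B := by
  intro x hx
  obtain ⟨y, hy, hxy⟩ := h x hx
  exact ⟨y, hy, hxy.trans hC⟩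

lemma NearSubset.add {C C' : ℝ} {A B A' B' : Set E} (h : NearSubset C A B)
    (h' : NearSubset C' A' B') : NearSubset (C + C') (A + A') (B + B') := by
  rintro _ ⟨x, hx, x', hx', rfl⟩
  obtain ⟨y, hy, hxy⟩ := h x hx
  obtain ⟨y', hy', hxy'⟩ := h' x' hx'
  refine ⟨y + y', add_mem_add hy hy', ?_⟩
  rw [add_sub_add_comm]
  exact (norm_add_le _ _).trans (add_le_add hxy hxy')

variable [InnerProductSpace ℝ E]

/-- The support function of a set. -/
noncomputable def supportFun (A : Set E) (p : E) : ℝ := sSup ((fun y => inner ℝ p y) '' A)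

variable {A B : Set E} {R C : ℝ} {p q y : E}

lemma bddAbove_inner_image (hA : ∀ y ∈ A, ‖y‖ ≤ R) (p : E) :
    BddAbove ((fun y => inner ℝ p y) '' A) := by
  refine ⟨‖p‖ * R, ?_⟩
  rintro _ ⟨y, hy, rfl⟩
  exact (real_inner_le_norm _ _).trans (mul_le_mul_of_nonneg_left (hA y hy) (norm_nonneg _))

lemma inner_le_supportFun (hA : ∀ y ∈ A, ‖y‖ ≤ R) (hy : y ∈ A) : inner ℝ p y ≤ supportFun A p :=
  le_csSup (bddAbove_inner_image hA p) (mem_image_of_mem _ hy)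

lemma supportFun_le (hA : A.Nonempty) {c : ℝ} (h : ∀ y ∈ A, inner ℝ p y ≤ c) :
    supportFun A p ≤ c :=
  csSup_le (hA.image _) (by rintro _ ⟨y, hy, rfl⟩; exact h y hy)

lemma abs_supportFun_le (hA0 : A.Nonempty) (hA : ∀ y ∈ A, ‖y‖ ≤ R) :
    |supportFun A p| ≤ ‖p‖ * R := by
  have h : ∀ y ∈ A, |inner ℝ p y| ≤ ‖p‖ * R := fun y hy =>
    (abs_real_inner_le_norm _ _).trans (mul_le_mul_of_nonneg_left (hA y hy) (norm_nonneg _))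
  refine abs_le.2 ⟨?_, supportFun_le hA0 fun y hy => (le_abs_self _).trans (h y hy)⟩
  obtain ⟨y, hy⟩ := hA0
  exact (abs_le.1 (h y hy)).1.trans (inner_le_supportFun hA hy)

lemma NearSubset.supportFun_le_add (h : NearSubset C A B) (hA : A.Nonempty)
    (hB : ∀ y ∈ B, ‖y‖ ≤ R) (p : E) : supportFun A p ≤ supportFun B p + ‖p‖ * C := by
  refine supportFun_le hA fun x hx => ?_
  obtain ⟨y, hy, hxy⟩ := h x hx
  have h1 := inner_le_supportFun (p := p) hB hy
  have h2 : inner ℝ p x = inner ℝ p y + inner ℝ p (x - y) := by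
    rw [← inner_add_right, add_sub_cancel]
  have h3 := (real_inner_le_norm p (x - y)).trans
    (mul_le_mul_of_nonneg_left hxy (norm_nonneg p))
  linarith

lemma supportFun_add {R' : ℝ} (hA0 : A.Nonempty) (hA : ∀ y ∈ A, ‖y‖ ≤ R) (hB0 : B.Nonempty)
    (hB : ∀ y ∈ B, ‖y‖ ≤ R') (p : E) : supportFun (A + B) p = supportFun A p + supportFun B p := by
  rw [supportFun, supportFun, supportFun, ← csSup_add (hA0.image _) (bddAbove_inner_image hA p)
    (hB0.image _) (bddAbove_inner_image hB p)]
  congr 1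
  exact image_add (innerSL ℝ p)

lemma supportFun_sub_le (hA0 : A.Nonempty) (hA : ∀ y ∈ A, ‖y‖ ≤ R) (p q : E) :
    supportFun A p - supportFun A q ≤ ‖p - q‖ * R := by
  rw [sub_le_iff_le_add]
  refine supportFun_le hA0 fun y hy => ?_
  have h1 := inner_le_supportFun (p := q) hA hy
  have h2 : inner ℝ p y = inner ℝ (p - q) y + inner ℝ q y := by
    rw [← inner_add_left, sub_add_cancel]
  have h3 := (real_inner_le_norm (p - q) y).trans
    (mul_le_mul_of_nonneg_left (hA y hy) (norm_nonneg _))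
  linarith

lemma abs_supportFun_sub_le (hA0 : A.Nonempty) (hA : ∀ y ∈ A, ‖y‖ ≤ R) (p q : E) :
    |supportFun A p - supportFun A q| ≤ ‖p - q‖ * R := by
  refine abs_le.2 ⟨?_, supportFun_sub_le hA0 hA p q⟩
  have := supportFun_sub_le hA0 hA q p
  rw [norm_sub_rev] at this
  linarith

end Support

/-! ### Measurability of the support function of the reachable set. -/

section Measurability

variable {E : Type*} [NormedAddCommGroup E] {Ω : Type*} {a : E → ℝ → Ω → ℝ} {t α β : ℝ}

lemma measurableSet_chainReach [MeasurableSpace Ω] {Q : Set E} (hQ : Q.Countable)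
    (ham : ∀ x r, Measurable fun ω => a x r ω) (L δ : ℝ) (i : ℕ) (z : E) :
    MeasurableSet {ω | ChainReach Q (fun x r => a x r ω) L δ i z} := by
  induction i generalizing z with
  | zero => exact MeasurableSet.const _
  | succ i ih =>
    have : {ω | ChainReach Q (fun x r => a x r ω) L δ (i + 1) z} = ⋃ z' ∈ Q,
        {ω | ChainReach Q (fun x r => a x r ω) L δ i z'} ∩
          {ω | ‖z - z'‖ ≤ δ * (a z' (i * δ) ω - L * δ)} := by
      ext ω
      simp only [ChainReach, mem_ofPred_eq, mem_iUnion, mem_inter_iff, exists_prop]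
    rw [this]
    exact .biUnion hQ fun z' _ => (ih z').inter
      (measurableSet_le measurable_const (((ham _ _).sub measurable_const).const_mul _))

/-- By continuity the Lipschitz inequality need only be tested on a countable dense set of pairs. -/
lemma measurableSet_lipschitzWith [MeasurableSpace Ω] [SecondCountableTopology E]
    (hlip : ∀ ω, ∃ K : ℝ≥0, LipschitzWith K fun p : E × ℝ => a p.1 p.2 ω)
    (ham : ∀ x r, Measurable fun ω => a x r ω) (K : ℝ≥0) :
    MeasurableSet {ω | LipschitzWith K fun p : E × ℝ => a p.1 p.2 ω} := by
  obtain ⟨D, hDc, hD⟩ := TopologicalSpace.exists_countable_dense (E × ℝ)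
  have : {ω | LipschitzWith K fun p : E × ℝ => a p.1 p.2 ω} = ⋂ p ∈ D, ⋂ q ∈ D,
      {ω | |a p.1 p.2 ω - a q.1 q.2 ω| ≤ K * dist p q} := by
    ext ω
    simp only [mem_iInter, mem_ofPred_eq]
    constructor
    · intro h p _ q _
      exact h.dist_le_mul p q
    · intro h
      obtain ⟨K', hK'⟩ := hlip ω
      have hc := hK'.continuous
      refine LipschitzWith.of_dist_le_mul fun p q => ?_
      have hcl : IsClosed {x : (E × ℝ) × (E × ℝ) |
          dist (a x.1.1 x.1.2 ω) (a x.2.1 x.2.2 ω) ≤ K * dist x.1 x.2} :=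
        isClosed_le ((hc.comp continuous_fst).dist (hc.comp continuous_snd))
          (continuous_dist.const_mul _)
      exact (hD.prod hD).induction (P := fun x : (E × ℝ) × (E × ℝ) =>
          dist (a x.1.1 x.1.2 ω) (a x.2.1 x.2.2 ω) ≤ K * dist x.1 x.2)
        (fun x hx => h x.1 hx.1 x.2 hx.2) hcl (p, q)
  rw [this]
  exact .biInter hDc fun p _ => .biInter hDc fun q _ =>
    measurableSet_le ((ham _ _).sub (ham _ _)).abs measurable_const

/-- The set of points reachable at time `t` from the origin at time `0`. -/
def reachFromOrigin (a : E → ℝ → Ω → ℝ) (t : ℝ) (ω : Ω) : Set E :=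
  {y | Reach (fun x r => a x r ω) 0 t 0 y}

lemma norm_le_of_mem_reachFromOrigin (hβ : ∀ x r ω, a x r ω ≤ β) (ht : 0 ≤ t) {ω : Ω} :
    ∀ y ∈ reachFromOrigin a t ω, ‖y‖ ≤ β * t := fun y hy => by
  simpa using Reach.norm_sub_le hy (fun x r => hβ x r ω) ht

variable [InnerProductSpace ℝ E]

lemma zero_mem_reachFromOrigin (hα0 : 0 ≤ α) (hα : ∀ x r ω, α ≤ a x r ω) (ht : 0 ≤ t) (ω : Ω) :
    0 ∈ reachFromOrigin a t ω := reach_self hα0 (fun x r => hα x r ω) ht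

variable [MeasurableSpace Ω]

/-- The support function exceeds `c` exactly when some chain in a countable dense set ends in the
open half-space `c < ⟪p, z⟫`. The Lipschitz constant depends on `ω`, so the union also runs over
natural bounds `k` for it. -/
lemma measurable_supportFun_reachFromOrigin [SecondCountableTopology E]
    (hlip : ∀ ω, ∃ K : ℝ≥0, LipschitzWith K fun p : E × ℝ => a p.1 p.2 ω)
    (ham : ∀ x r, Measurable fun ω => a x r ω) (hα0 : 0 < α) (hα : ∀ x r ω, α ≤ a x r ω)
    (hβ0 : 0 ≤ β) (hβ : ∀ x r ω, a x r ω ≤ β) (ht : 0 < t) (p : E) :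
    Measurable fun ω => supportFun (reachFromOrigin a t ω) p := by
  obtain ⟨D, hDc, hD⟩ := TopologicalSpace.exists_countable_dense E
  set Q := insert (0 : E) D
  have hQc : Q.Countable := hDc.insert 0
  have hQ : Dense Q := hD.mono (subset_insert _ _)
  refine measurable_of_Ioi fun c => ?_
  have : (fun ω => supportFun (reachFromOrigin a t ω) p) ⁻¹' Ioi c =
      ⋃ k : ℕ, ⋃ m : ℕ, ⋃ z ∈ Q, {ω | LipschitzWith k fun p : E × ℝ => a p.1 p.2 ω} ∩
        ({ω | ChainReach Q (fun x r => a x r ω) (k * (β + 1)) (t / (m + 1)) (m + 1) z} ∩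
          {_ω | c < inner ℝ p z}) := by
    ext ω
    simp only [mem_preimage, mem_Ioi, mem_iUnion, mem_inter_iff, mem_ofPred_eq, exists_prop]
    constructor
    · intro h
      obtain ⟨_, ⟨y, hy, rfl⟩, hcy⟩ := exists_lt_of_lt_csSup
        (Nonempty.image _ ⟨0, zero_mem_reachFromOrigin hα0.le hα ht.le ω⟩) h
      obtain ⟨K, hK⟩ := hlip ω
      obtain ⟨k, hk⟩ := exists_nat_ge K
      have hK' : LipschitzWith (k : ℝ≥0) fun p : E × ℝ => a p.1 p.2 ω := hK.weaken hk
      have hcont : Continuous fun z : E => inner ℝ p z := by fun_prop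
      obtain ⟨ε, hε, hball⟩ := Metric.isOpen_iff.1 (isOpen_lt continuous_const hcont) y hcy
      obtain ⟨m, z, hz, hch, hzy⟩ := Reach.exists_chainReach_near hy ht hQ (mem_insert _ _)
        hK' hα0 (fun x r => hα x r ω) (fun x r => hβ x r ω) hβ0 rfl hε
      refine ⟨k, m, z, hz, hK', by simpa using hch, hball ?_⟩
      rwa [Metric.mem_ball, dist_eq_norm]
    · rintro ⟨k, m, z, -, hK, hch, hcz⟩
      have h1 := hch.reach hK (fun x r => hβ x r ω) hβ0 (by simp) (by positivity)
      have h2 : ((m + 1 : ℕ) : ℝ) * (t / (m + 1)) = t := by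
        push_cast
        field_simp
      rw [h2] at h1
      exact hcz.trans_le
        (inner_le_supportFun (norm_le_of_mem_reachFromOrigin hβ ht.le) h1)
  rw [this]
  exact .iUnion fun k => .iUnion fun m => .biUnion hQc fun z _ =>
    (measurableSet_lipschitzWith hlip ham _).inter
      ((measurableSet_chainReach hQc ham _ _ _ _).inter (.const _))

end Measurability

/-! ### Convergence of almost additive sequences. -/

section Sequences

/-- If `u (j + N) = u j + g j` up to an error `c`, then the sum of the `g j` is `N * u k`, up to an
error of order `c * k`. -/
lemma abs_sum_sub_mul_le {u g : ℕ → ℝ} {c d : ℝ} {N : ℕ} (hd : 0 ≤ d)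
    (hadd : ∀ j, |u (j + N) - u j - g j| ≤ c) (hinc : ∀ k i, |u (k + i) - u k| ≤ d * i)
    (h0 : u 0 = 0) (k : ℕ) :
    |∑ j ∈ Finset.range k, g j - N * u k| ≤ k * c + 2 * (N * (d * N)) := by
  -- The window sum has increment `u (k + N) - u k`, close to `g k`, so `∑ g` telescopes to `F k - F
  -- 0`; and `F k` is close to `N * u k`.
  set F : ℕ → ℝ := fun k => ∑ i ∈ Finset.range N, u (k + i) with hF
  have hstep : ∀ k, F (k + 1) = F k + (u (k + N) - u k) := fun k => by
    have h1 := Finset.sum_range_succ (fun i => u (k + i)) N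
    rw [Finset.sum_range_succ'] at h1
    simp only [add_zero] at h1
    have h2 : F (k + 1) = ∑ i ∈ Finset.range N, u (k + (i + 1)) :=
      Finset.sum_congr rfl fun i _ => by rw [add_assoc, add_comm 1 i]
    rw [h2]
    simp only [hF]
    linarith
  have h1 : |∑ j ∈ Finset.range k, g j - (F k - F 0)| ≤ k * c := by
    induction k with
    | zero => simp
    | succ k ih =>
      rw [Finset.sum_range_succ, hstep]
      have h2 := hadd k
      push_cast
      rw [abs_le] at ih h2 ⊢
      constructor <;> linarith [ih.1, ih.2, h2.1, h2.2]
  have h2 : ∀ k, |F k - N * u k| ≤ N * (d * N) := fun k => by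
    have h3 : F k - N * u k = ∑ i ∈ Finset.range N, (u (k + i) - u k) := by
      simp [hF, Finset.sum_sub_distrib]
    rw [h3]
    refine (Finset.abs_sum_le_sum_abs _ _).trans ?_
    calc ∑ i ∈ Finset.range N, |u (k + i) - u k| ≤ ∑ _i ∈ Finset.range N, d * N := by
          refine Finset.sum_le_sum fun i hi => (hinc k i).trans ?_
          have : (i : ℝ) ≤ N := by exact_mod_cast (Finset.mem_range.1 hi).le
          gcongr
      _ = N * (d * N) := by simp
  have h3 := h2 k
  have h4 := h2 0
  rw [h0, mul_zero, sub_zero] at h4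
  rw [abs_le] at h1 h3 h4 ⊢
  constructor <;> linarith [h1.1, h1.2, h3.1, h3.2, h4.1, h4.2]

/-- Late terms of `v` cluster around the single number `f N`, so `v` is Cauchy; letting `k → ∞`
gives `|H - f N| ≤ c / N`. In the application `f` is deterministic, which makes `H` independent of
`ω`. -/
lemma exists_tendsto_of_eventually_abs_sub_le {v f : ℕ → ℝ} {c : ℝ} {T : ℕ}
    (h : ∀ N, T ≤ N → ∀ ε > 0, ∀ᶠ k in atTop, |v k - f N| ≤ c / N + ε) :
    ∃ H, Tendsto v atTop (𝓝 H) ∧ Tendsto f atTop (𝓝 H) := by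
  have hcN : Tendsto (fun N : ℕ => c / N) atTop (𝓝 0) := tendsto_const_div_atTop_nhds_zero_nat c
  have hv : CauchySeq v := by
    refine Metric.cauchySeq_iff'.2 fun ε hε => ?_
    obtain ⟨N, hN1, hN2⟩ := ((hcN.eventually (gt_mem_nhds (show 0 < ε / 4 by positivity))).and
      (eventually_ge_atTop T)).exists
    obtain ⟨k₀, hk₀⟩ := eventually_atTop.1 (h N hN2 (ε / 8) (by positivity))
    refine ⟨k₀, fun k hk => ?_⟩
    have h1 := abs_le.1 (hk₀ k hk)
    have h2 := abs_le.1 (hk₀ k₀ le_rfl)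
    rw [Real.dist_eq, abs_lt]
    constructor <;> linarith [h1.1, h1.2, h2.1, h2.2]
  obtain ⟨H, hH⟩ := cauchySeq_tendsto_of_complete hv
  refine ⟨H, hH, ?_⟩
  rw [tendsto_iff_norm_sub_tendsto_zero]
  refine squeeze_zero' (Eventually.of_forall fun _ => norm_nonneg _) ?_ hcN
  filter_upwards [eventually_ge_atTop T] with N hN
  rw [norm_sub_rev, Real.norm_eq_abs]
  refine le_of_forall_pos_le_add fun ε hε => ?_
  exact le_of_tendsto (hH.sub_const _).abs (h N hN ε hε)

end Sequences

/-! ### Minkowski sums and convex hulls. -/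

section Convexity

variable {E : Type*} [NormedAddCommGroup E]

lemma nearSubset_refl (A : Set E) : NearSubset 0 A A := fun x hx => ⟨x, hx, by simp⟩

lemma nearSubset_of_subset {A B : Set E} (h : A ⊆ B) : NearSubset 0 A B :=
  fun x hx => ⟨x, h hx, by simp⟩

lemma NearSubset.smul [NormedSpace ℝ E] {A B : Set E} {C : ℝ} (h : NearSubset C A B) (c : ℝ) :
    NearSubset (|c| * C) (c • A) (c • B) := by
  rintro _ ⟨x, hx, rfl⟩
  obtain ⟨y, hy, hxy⟩ := h x hx
  refine ⟨c • y, smul_mem_smul_set hy, ?_⟩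
  simp only
  rw [← smul_sub, norm_smul, Real.norm_eq_abs]
  gcongr

/-- The hull of `B` plus a ball is the hull of `B` plus the same ball. -/
lemma NearSubset.convexHull [NormedSpace ℝ E] {A B : Set E} {C : ℝ} (h : NearSubset C A B) :
    NearSubset C (convexHull ℝ A) (convexHull ℝ B) := by
  have h1 : A ⊆ B + Metric.closedBall 0 C := by
    intro x hx
    obtain ⟨y, hy, hxy⟩ := h x hx
    exact ⟨y, hy, x - y, by simpa using hxy, by simp⟩
  intro x hx
  have h2 := convexHull_mono h1 hx
  rw [convexHull_add, (convex_closedBall (0 : E) C).convexHull_eq] at h2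
  obtain ⟨y, hy, w, hw, rfl⟩ := h2
  exact ⟨y, hy, by simpa using hw⟩

variable [InnerProductSpace ℝ E]

/-- Otherwise `S`, and with it its hull, would lie in an open half-space that excludes `z`. -/
lemma exists_inner_sub_nonpos {S : Set E} {z : E} (hz : z ∈ convexHull ℝ S) (e : E) :
    ∃ y ∈ S, inner ℝ e (y - z) ≤ 0 := by
  by_contra! h
  have h1 : convexHull ℝ S ⊆ {y | inner ℝ e z < inner ℝ e y} := by
    refine convexHull_min (fun y hy => ?_) ?_
    · have := h y hy
      rw [inner_sub_right] at this
      exact sub_pos.1 this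
    · exact convex_halfSpace_gt (innerSL ℝ e).toLinearMap.isLinear _
  exact lt_irrefl (inner ℝ e z) (h1 hz)

/-- A Minkowski sum of `m` bounded sets is within `O(√m)` of its convex hull. -/
lemma exists_mem_sum_norm_sub_sq_le {S : ℕ → Set E} {ρ : ℝ} (hS : ∀ j, ∀ y ∈ S j, ‖y‖ ≤ ρ)
    (m : ℕ) {z : E} (hz : z ∈ ∑ j ∈ Finset.range m, convexHull ℝ (S j)) :
    ∃ y ∈ ∑ j ∈ Finset.range m, S j, ‖y - z‖ ^ 2 ≤ m * (2 * ρ) ^ 2 := by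
  induction m generalizing z with
  | zero => exact ⟨z, hz, by simp⟩
  | succ m ih =>
    rw [Finset.sum_range_succ] at hz ⊢
    obtain ⟨z₁, hz₁, z₂, hz₂, rfl⟩ := hz
    obtain ⟨y₁, hy₁, h1⟩ := ih hz₁
    -- The new error makes a nonpositive inner product with the accumulated one, so the cross term
    -- drops and squared errors add.
    obtain ⟨y₂, hy₂, h2⟩ := exists_inner_sub_nonpos hz₂ (y₁ - z₁)
    refine ⟨y₁ + y₂, add_mem_add hy₁ hy₂, ?_⟩
    have h3 : ‖z₂‖ ≤ ρ := by
      have : convexHull ℝ (S m) ⊆ Metric.closedBall 0 ρ :=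
        convexHull_min (fun y hy => by simpa using hS m y hy) (convex_closedBall _ _)
      simpa using this hz₂
    have h4 : ‖y₂ - z₂‖ ≤ 2 * ρ :=
      (norm_sub_le _ _).trans (by linarith [hS m y₂ hy₂])
    simp only
    rw [add_sub_add_comm, norm_add_sq_real]
    push_cast
    nlinarith [norm_nonneg (y₂ - z₂)]

end Convexity

/-! ### Almost additivity and asymptotic convexity of the reachable sets. -/

section Evolution

variable {n : ℕ} {Ω : Type*} {a : EuclideanSpace ℝ (Fin n) → ℝ → Ω → ℝ} {S : ℕ → Ω → Ω}
  {α β : ℝ} {T : ℕ}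

lemma mem_reachFromOrigin_shift (hS : ∀ x t k ω, a x t (S k ω) = a x (t + k) ω) {t : ℝ} {N : ℕ}
    {ω : Ω} {y : EuclideanSpace ℝ (Fin n)} :
    y ∈ reachFromOrigin a t (S N ω) ↔ Reach (fun x r => a x r ω) N (N + t) 0 y := by
  have h := reach_comp_add_time (b := fun x r => a x r ω) (s := 0) (t := t) (x := 0) (y := y) N
  rw [zero_add, add_comm t] at h
  rw [← h, reachFromOrigin]
  simp only [hS, mem_ofPred_eq]

/-- The path is cut at time `N`, and its remaining displacement is imitated from the origin. -/
lemma nearSubset_reachFromOrigin_add (hS : ∀ x t k ω, a x t (S k ω) = a x (t + k) ω)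
    (hper : ∀ (l : Fin n → ℤ) x r ω, a (x + latticePoint l) r ω = a x r ω)
    (hα : ∀ x r ω, α ≤ a x r ω) (hβ : ∀ x r ω, a x r ω ≤ β) (hT : √n ≤ α * T) (N : ℕ) {t : ℝ}
    (ht : T ≤ t) (ω : Ω) :
    NearSubset (β * T + √n) (reachFromOrigin a (N + t) ω)
      (reachFromOrigin a N ω + reachFromOrigin a t (S N ω)) := by
  intro y hy
  have hT0 : (0 : ℝ) ≤ T := T.cast_nonneg
  obtain ⟨z, hz, hzy⟩ := Reach.exists_between hy (m := N) N.cast_nonneg (by linarith)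
  obtain ⟨y', hy', h⟩ := hzy.exists_near_displacement (fun x r => hα x r ω) (fun x r => hβ x r ω)
    (fun l x r => hper l x r ω) hT0 hT (by linarith) 0
  refine ⟨z + y', add_mem_add hz ((mem_reachFromOrigin_shift hS).2 hy'), ?_⟩
  rwa [norm_sub_rev, show z + y' - y = (y' - 0) - (y - z) by abel]

lemma nearSubset_add_reachFromOrigin (hS : ∀ x t k ω, a x t (S k ω) = a x (t + k) ω)
    (hper : ∀ (l : Fin n → ℤ) x r ω, a (x + latticePoint l) r ω = a x r ω)
    (hα : ∀ x r ω, α ≤ a x r ω) (hβ : ∀ x r ω, a x r ω ≤ β) (hT : √n ≤ α * T) (N : ℕ) {t : ℝ}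
    (ht : T ≤ t) (ω : Ω) :
    NearSubset (β * T + √n) (reachFromOrigin a N ω + reachFromOrigin a t (S N ω))
      (reachFromOrigin a (N + t) ω) := by
  rintro _ ⟨z, hz, w, hw, rfl⟩
  have hT0 : (0 : ℝ) ≤ T := T.cast_nonneg
  obtain ⟨y', hy', h⟩ := ((mem_reachFromOrigin_shift hS).1 hw).exists_near_displacement
    (fun x r => hα x r ω) (fun x r => hβ x r ω) (fun l x r => hper l x r ω) hT0 hT (by linarith) z
  refine ⟨y', Reach.trans hz hy' N.cast_nonneg (by linarith), ?_⟩
  rwa [norm_sub_rev, show y' - (z + w) = (y' - z) - (w - 0) by abel]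

lemma reachFromOrigin_mono (hα0 : 0 ≤ α) (hα : ∀ x r ω, α ≤ a x r ω) {s t : ℝ} (hs : 0 ≤ s)
    (hst : s ≤ t) (ω : Ω) : reachFromOrigin a s ω ⊆ reachFromOrigin a t ω :=
  fun _ hy => Reach.trans hy (reach_self hα0 (fun x r => hα x r ω) hst) hs hst

lemma nearSubset_reachFromOrigin_of_le (hβ : ∀ x r ω, a x r ω ≤ β) {s t : ℝ} (hs : 0 ≤ s)
    (hst : s ≤ t) (ω : Ω) :
    NearSubset (β * (t - s)) (reachFromOrigin a t ω) (reachFromOrigin a s ω) := by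
  intro y hy
  obtain ⟨z, hz, hzy⟩ := Reach.exists_between hy hs hst
  exact ⟨z, hz, hzy.norm_sub_le (fun x r => hβ x r ω) hst⟩

lemma reachFromOrigin_zero (hα0 : 0 ≤ α) (hα : ∀ x r ω, α ≤ a x r ω) (hβ : ∀ x r ω, a x r ω ≤ β)
    (ω : Ω) : reachFromOrigin a 0 ω = {0} := by
  refine Subset.antisymm (fun y hy => ?_)
    (singleton_subset_iff.2 (zero_mem_reachFromOrigin hα0 hα le_rfl ω))
  simpa using norm_le_of_mem_reachFromOrigin hβ le_rfl y hy

lemma abs_supportFun_reachFromOrigin_sub_le (hα0 : 0 ≤ α) (hα : ∀ x r ω, α ≤ a x r ω)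
    (hβ : ∀ x r ω, a x r ω ≤ β) {s t : ℝ} (hs : 0 ≤ s) (hst : s ≤ t) (ω : Ω)
    (p : EuclideanSpace ℝ (Fin n)) :
    |supportFun (reachFromOrigin a t ω) p - supportFun (reachFromOrigin a s ω) p|
      ≤ ‖p‖ * (β * (t - s)) := by
  have h1 := (nearSubset_reachFromOrigin_of_le hβ hs hst ω).supportFun_le_add
    ⟨0, zero_mem_reachFromOrigin hα0 hα (hs.trans hst) ω⟩ (norm_le_of_mem_reachFromOrigin hβ hs) p
  have h2 := (nearSubset_of_subset (reachFromOrigin_mono hα0 hα hs hst ω)).supportFun_le_add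
    ⟨0, zero_mem_reachFromOrigin hα0 hα hs ω⟩
    (norm_le_of_mem_reachFromOrigin hβ (hs.trans hst)) p
  have h3 := (abs_nonneg _).trans (abs_supportFun_le (p := p)
    ⟨0, zero_mem_reachFromOrigin hα0 hα (sub_nonneg.2 hst) ω⟩
    (norm_le_of_mem_reachFromOrigin hβ (sub_nonneg.2 hst)))
  rw [abs_le]
  constructor <;> linarith

lemma abs_supportFun_reachFromOrigin_add_le (hS : ∀ x t k ω, a x t (S k ω) = a x (t + k) ω)
    (hper : ∀ (l : Fin n → ℤ) x r ω, a (x + latticePoint l) r ω = a x r ω) (hα0 : 0 ≤ α)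
    (hα : ∀ x r ω, α ≤ a x r ω) (hβ : ∀ x r ω, a x r ω ≤ β) (hT : √n ≤ α * T) (N : ℕ) {t : ℝ}
    (ht : T ≤ t) (ω : Ω) (p : EuclideanSpace ℝ (Fin n)) :
    |supportFun (reachFromOrigin a (N + t) ω) p - supportFun (reachFromOrigin a N ω) p
      - supportFun (reachFromOrigin a t (S N ω)) p| ≤ ‖p‖ * (β * T + √n) := by
  have ht0 : 0 ≤ t := le_trans T.cast_nonneg ht
  have hN0 : (0 : ℝ) ≤ N := N.cast_nonneg
  have hne : ∀ {s : ℝ} (ω : Ω), 0 ≤ s → (reachFromOrigin a s ω).Nonempty := fun ω hs =>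
    ⟨0, zero_mem_reachFromOrigin hα0 hα hs ω⟩
  have hb1 := norm_le_of_mem_reachFromOrigin hβ hN0 (ω := ω)
  have hb2 := norm_le_of_mem_reachFromOrigin hβ ht0 (ω := S N ω)
  have hb3 : ∀ y ∈ reachFromOrigin a N ω + reachFromOrigin a t (S N ω), ‖y‖ ≤ β * N + β * t := by
    rintro _ ⟨y, hy, z, hz, rfl⟩
    exact (norm_add_le _ _).trans (add_le_add (hb1 y hy) (hb2 z hz))
  have h1 := (nearSubset_reachFromOrigin_add hS hper hα hβ hT N ht ω).supportFun_le_add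
    (hne ω (by linarith)) hb3 p
  have h2 := (nearSubset_add_reachFromOrigin hS hper hα hβ hT N ht ω).supportFun_le_add
    ((hne ω hN0).add (hne _ ht0)) (norm_le_of_mem_reachFromOrigin hβ (by linarith)) p
  rw [supportFun_add (hne ω hN0) hb1 (hne _ ht0) hb2] at h1 h2
  rw [abs_le]
  constructor <;> linarith

lemma nearSubset_reachFromOrigin_mul (hS : ∀ x t k ω, a x t (S k ω) = a x (t + k) ω)
    (hper : ∀ (l : Fin n → ℤ) x r ω, a (x + latticePoint l) r ω = a x r ω) (hα0 : 0 ≤ α)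
    (hα : ∀ x r ω, α ≤ a x r ω) (hβ : ∀ x r ω, a x r ω ≤ β) (hT : √n ≤ α * T) {N : ℕ}
    (hN : T ≤ N) (m : ℕ) (ω : Ω) :
    NearSubset (m * (β * T + √n)) (reachFromOrigin a (m * N : ℕ) ω)
        (∑ j ∈ Finset.range m, reachFromOrigin a N (S (j * N) ω)) ∧
      NearSubset (m * (β * T + √n)) (∑ j ∈ Finset.range m, reachFromOrigin a N (S (j * N) ω))
        (reachFromOrigin a (m * N : ℕ) ω) := by
  induction m with
  | zero =>
    simp only [Nat.cast_zero, reachFromOrigin_zero hα0 hα hβ, zero_mul,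
      Finset.range_zero, Finset.sum_empty]
    exact ⟨nearSubset_refl _, nearSubset_refl _⟩
  | succ m ih =>
    have hN' : (T : ℝ) ≤ N := by exact_mod_cast hN
    have h1 := nearSubset_reachFromOrigin_add hS hper hα hβ hT (m * N) hN' ω
    have h2 := nearSubset_add_reachFromOrigin hS hper hα hβ hT (m * N) hN' ω
    have h3 : (((m + 1) * N : ℕ) : ℝ) = (m * N : ℕ) + N := by push_cast; ring
    rw [Finset.sum_range_succ, h3]
    constructor
    · refine (h1.trans (ih.1.add (nearSubset_refl _))).mono (le_of_eq ?_)
      push_cast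
      ring
    · refine ((ih.2.add (nearSubset_refl _)).trans h2).mono (le_of_eq ?_)
      push_cast
      ring

lemma nearSubset_convexHull_reachFromOrigin_mul (hS : ∀ x t k ω, a x t (S k ω) = a x (t + k) ω)
    (hper : ∀ (l : Fin n → ℤ) x r ω, a (x + latticePoint l) r ω = a x r ω) (hα0 : 0 ≤ α)
    (hα : ∀ x r ω, α ≤ a x r ω) (hβ0 : 0 ≤ β) (hβ : ∀ x r ω, a x r ω ≤ β) (hT : √n ≤ α * T)
    {N : ℕ} (hN : T ≤ N) (m : ℕ) (ω : Ω) :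
    NearSubset (2 * (m * (β * T + √n)) + √m * (2 * (β * N)))
      (convexHull ℝ (reachFromOrigin a (m * N : ℕ) ω)) (reachFromOrigin a (m * N : ℕ) ω) := by
  obtain ⟨h1, h2⟩ := nearSubset_reachFromOrigin_mul hS hper hα0 hα hβ hT hN m ω
  have h3 : NearSubset (√m * (2 * (β * N)))
      (convexHull ℝ (∑ j ∈ Finset.range m, reachFromOrigin a N (S (j * N) ω)))
      (∑ j ∈ Finset.range m, reachFromOrigin a N (S (j * N) ω)) := by
    intro z hz
    rw [convexHull_sum] at hz
    obtain ⟨y, hy, hyz⟩ := exists_mem_sum_norm_sub_sq_le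
      (fun j => norm_le_of_mem_reachFromOrigin hβ N.cast_nonneg (ω := S (j * N) ω)) m hz
    refine ⟨y, hy, ?_⟩
    rw [norm_sub_rev]
    refine le_of_sq_le_sq ?_ (by positivity)
    rwa [mul_pow, Real.sq_sqrt m.cast_nonneg]
  exact ((h1.convexHull.trans h3).trans h2).mono (by linarith)

/-- The reachable sets are asymptotically convex. -/
lemma exists_nearSubset_convexHull_reachFromOrigin
    (hS : ∀ x t k ω, a x t (S k ω) = a x (t + k) ω)
    (hper : ∀ (l : Fin n → ℤ) x r ω, a (x + latticePoint l) r ω = a x r ω) (hα0 : 0 ≤ α)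
    (hα : ∀ x r ω, α ≤ a x r ω) (hβ0 : 0 ≤ β) (hβ : ∀ x r ω, a x r ω ≤ β) (hT : √n ≤ α * T)
    {ε : ℝ} (hε : 0 < ε) :
    ∃ t₀ : ℝ, ∀ t ≥ t₀, ∀ ω, NearSubset (ε * t) (convexHull ℝ (reachFromOrigin a t ω))
      (reachFromOrigin a t ω) := by
  -- `N` makes the error linear in `m` at most `ε / 2 * t`. With `N` fixed, the other errors are
  -- `O(√t)`: one `β * N * √t` from cutting `t` down to `m * N`, two from the Minkowski sum. The
  -- choice of `r` absorbs all three.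
  obtain ⟨N, hN1, hN2, hN0⟩ :=
    (((tendsto_const_div_atTop_nhds_zero_nat (2 * (β * T + √n))).eventually
      (gt_mem_nhds (show 0 < ε / 2 by positivity))).and
      ((eventually_ge_atTop T).and (eventually_gt_atTop 0))).exists
  have hN0' : (0 : ℝ) < N := by exact_mod_cast hN0
  have hN1' : (1 : ℝ) ≤ N := by exact_mod_cast hN0
  set r := 1 + 6 * (β * N) / ε with hr
  have hr1 : 1 ≤ r := le_add_of_nonneg_right (by positivity)
  refine ⟨r ^ 2, fun t ht ω => ?_⟩
  have ht0 : 0 < t := lt_of_lt_of_le (by positivity) ht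
  set m := ⌊t / N⌋₊ with hm
  have hm1 : (m : ℝ) ≤ t / N := Nat.floor_le (by positivity)
  have hm2 : t / N < m + 1 := Nat.lt_floor_add_one _
  have hmt : ((m * N : ℕ) : ℝ) ≤ t := by
    push_cast
    rwa [← le_div_iff₀ hN0']
  have hmt2 : t - ((m * N : ℕ) : ℝ) ≤ N := by
    rw [div_lt_iff₀ hN0'] at hm2
    push_cast
    linarith
  have h1 := (nearSubset_reachFromOrigin_of_le hβ (Nat.cast_nonneg _) hmt ω).convexHull
  have h2 := nearSubset_convexHull_reachFromOrigin_mul hS hper hα0 hα hβ0 hβ hT hN2 m ω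
  have h3 := nearSubset_of_subset (reachFromOrigin_mono hα0 hα (Nat.cast_nonneg _) hmt ω)
  refine ((h1.trans h2).trans h3).mono ?_
  have hsq : √t * √t = t := Real.mul_self_sqrt ht0.le
  have hrt : r ≤ √t := Real.le_sqrt_of_sq_le ht
  have hmt3 : √m ≤ √t :=
    Real.sqrt_le_sqrt (hm1.trans (div_le_self ht0.le hN1'))
  have e1 : β * (t - ((m * N : ℕ) : ℝ)) ≤ β * N * √t := by
    calc β * (t - ((m * N : ℕ) : ℝ)) ≤ β * N * 1 := by rw [mul_one]; gcongr
      _ ≤ β * N * √t := by gcongr; linarith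
  have e2 : 2 * (m * (β * T + √n)) ≤ ε / 2 * t := by
    calc 2 * (m * (β * T + √n)) ≤ 2 * (t / N * (β * T + √n)) := by gcongr
      _ = 2 * (β * T + √n) / N * t := by ring
      _ ≤ ε / 2 * t := by gcongr
  have e3 : √m * (2 * (β * N)) ≤ 2 * (β * N) * √t := by rw [mul_comm]; gcongr
  have e4 : 3 * (β * N) ≤ ε / 2 * √t := by
    have : 6 * (β * N) / ε ≤ √t := by linarith
    rw [div_le_iff₀ hε] at this
    linarith
  have e5 : 3 * (β * N) * √t ≤ ε / 2 * √t * √t := by gcongr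
  rw [mul_assoc (ε / 2), hsq] at e5
  linarith

end Evolution

/-! ### Almost sure growth rate of the support functions. -/

section AlmostSure

variable {n : ℕ} {Ω : Type*} [MeasurableSpace Ω] {μ : Measure Ω} [IsProbabilityMeasure μ]
  {τ : ℤ → Ω → Ω} {a : EuclideanSpace ℝ (Fin n) → ℝ → Ω → ℝ} {α β : ℝ} {T : ℕ}

/-- The support functions of the reachable sets have a deterministic growth rate. -/
lemma exists_ae_tendsto_supportFun_div (hτ : IsErgodicGroup μ τ)
    (hS : ∀ x t (k : ℕ) ω, a x t (τ k ω) = a x (t + k) ω)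
    (hper : ∀ (l : Fin n → ℤ) x r ω, a (x + latticePoint l) r ω = a x r ω)
    (hlip : ∀ ω, ∃ K : ℝ≥0, LipschitzWith K fun p : EuclideanSpace ℝ (Fin n) × ℝ => a p.1 p.2 ω)
    (ham : ∀ x r, Measurable fun ω => a x r ω) (hα0 : 0 < α) (hα : ∀ x r ω, α ≤ a x r ω)
    (hβ0 : 0 ≤ β) (hβ : ∀ x r ω, a x r ω ≤ β) (hT : √n ≤ α * T)
    (p : EuclideanSpace ℝ (Fin n)) :
    ∃ H : ℝ, ∀ᵐ ω ∂μ, Tendsto (fun k : ℕ => supportFun (reachFromOrigin a k ω) p / k) atTop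
      (𝓝 H) := by
  set h : ℕ → Ω → ℝ := fun k ω => supportFun (reachFromOrigin a k ω) p with hh
  have hinc : ∀ ω k i, |h (k + i) ω - h k ω| ≤ ‖p‖ * β * i := fun ω k i => by
    have := abs_supportFun_reachFromOrigin_sub_le hα0.le hα hβ (s := k) (t := (k + i : ℕ))
      k.cast_nonneg (by exact_mod_cast Nat.le_add_right k i) ω p
    refine this.trans (le_of_eq ?_)
    push_cast
    ring
  have hzero : ∀ ω, h 0 ω = 0 := fun ω => by
    simp [hh, reachFromOrigin_zero hα0.le hα hβ, supportFun]
  have hbound : ∀ N ω, |h N ω| ≤ ‖p‖ * (β * N) := fun N ω =>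
    abs_supportFun_le ⟨0, zero_mem_reachFromOrigin hα0.le hα N.cast_nonneg ω⟩
      (norm_le_of_mem_reachFromOrigin hβ N.cast_nonneg)
  have hadd : ∀ N, T ≤ N → ∀ ω (j : ℕ),
      |h (j + N) ω - h j ω - h N (τ j ω)| ≤ ‖p‖ * (β * T + √n) := fun N hN ω j => by
    have := abs_supportFun_reachFromOrigin_add_le (S := fun k ω => τ k ω) hS hper hα0.le hα hβ hT
      j (t := N) (by exact_mod_cast hN) ω p
    simpa [hh] using this
  have hmeas : ∀ N, Measurable (h N) := fun N => by
    rcases Nat.eq_zero_or_pos N with rfl | hN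
    · rw [funext hzero]
      exact measurable_const
    · exact measurable_supportFun_reachFromOrigin hlip ham hα0 hα hβ0 hβ (by exact_mod_cast hN) p
  have hint : ∀ N, Integrable (h N) μ := fun N =>
    Integrable.of_bound (hmeas N).aestronglyMeasurable _ (Eventually.of_forall (hbound N))
  have hbirk : ∀ᵐ ω ∂μ, ∀ N, Tendsto (fun k : ℕ => birkhoffAverage ℝ (τ 1) (h N) k ω) atTop
      (𝓝 (∫ ω, h N ω ∂μ)) :=
    ae_all_iff.2 fun N => ae_tendsto_birkhoffAverage hτ.ergodic_one (hint N) (hmeas N)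
  set f : ℕ → ℝ := fun N => (∫ ω, h N ω ∂μ) / N with hf
  have key : ∀ᵐ ω ∂μ, ∃ H, Tendsto (fun k : ℕ => h k ω / k) atTop (𝓝 H) ∧
      Tendsto f atTop (𝓝 H) := by
    filter_upwards [hbirk] with ω hω
    refine exists_tendsto_of_eventually_abs_sub_le (c := ‖p‖ * (β * T + √n)) (T := max T 1)
      fun N hN ε hε => ?_
    have hNpos : (0 : ℝ) < N := by exact_mod_cast (le_max_right T 1).trans hN
    have hlim1 := (hω N).div_const (N : ℝ)
    set c₂ := 2 * (N * (‖p‖ * β * N)) / N with hc₂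
    have hlim2 : Tendsto (fun k : ℕ => c₂ / k) atTop (𝓝 0) :=
      tendsto_const_div_atTop_nhds_zero_nat _
    filter_upwards [Metric.tendsto_nhds.1 hlim1 (ε / 2) (by positivity),
      hlim2.eventually (gt_mem_nhds (show 0 < ε / 2 by positivity)), eventually_gt_atTop 0]
      with k hk1 hk2 hk0
    have hk0' : (0 : ℝ) < k := by exact_mod_cast hk0
    have h1 := abs_sum_sub_mul_le (u := fun k => h k ω) (g := fun j => h N (τ j ω)) (by positivity)
      (hadd N ((le_max_left T 1).trans hN) ω) (hinc ω) (hzero ω) k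
    have h2 : birkhoffAverage ℝ (τ 1) (h N) k ω = (∑ j ∈ Finset.range k, h N (τ j ω)) / k := by
      rw [birkhoffAverage, birkhoffSum, smul_eq_mul, inv_mul_eq_div]
      simp only [hτ.iterate_one]
    rw [h2, Real.dist_eq] at hk1
    have h3 : |h k ω / k - (∑ j ∈ Finset.range k, h N (τ j ω)) / k / N|
        ≤ ‖p‖ * (β * T + √n) / N + c₂ / k := by
      have h4 : h k ω / k - (∑ j ∈ Finset.range k, h N (τ j ω)) / k / N
          = -((∑ j ∈ Finset.range k, h N (τ j ω)) - N * h k ω) / (k * N) := by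
        field_simp
        ring
      rw [h4, abs_div, abs_neg, abs_of_pos (mul_pos hk0' hNpos), div_le_iff₀ (mul_pos hk0' hNpos)]
      refine h1.trans (le_of_eq ?_)
      rw [hc₂]
      field_simp
    have h5 := abs_sub_le (h k ω / k) ((∑ j ∈ Finset.range k, h N (τ j ω)) / k / N) (f N)
    have h6 : |(∑ j ∈ Finset.range k, h N (τ j ω)) / k / N - f N| < ε / 2 := hk1
    linarith
  -- The sequence `f` does not involve `ω`, so its limit, read off at one sample point, serves for
  -- all.
  obtain ⟨ω₀, H, -, hH⟩ := key.exists
  refine ⟨H, ?_⟩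
  filter_upwards [key] with ω ⟨H', hH', hf'⟩
  rwa [tendsto_nhds_unique hH hf']

end AlmostSure

/-! ### From pointwise limits of support functions to set distances. -/

section Separation

variable {E : Type*} [NormedAddCommGroup E] [InnerProductSpace ℝ E]

/-- The unit vector points from the projection of `x` on the closure of `K` towards `x`. -/
lemma exists_unit_separation [CompleteSpace E] {K : Set E} (hK0 : K.Nonempty) (hK : Convex ℝ K)
    {x : E} {ε : ℝ} (hε : 0 < ε) (hx : ∀ y ∈ K, ε ≤ ‖x - y‖) :
    ∃ p : E, ‖p‖ = 1 ∧ ∀ y ∈ K, inner ℝ p y + ε ≤ inner ℝ p x := by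
  obtain ⟨v, hv, hmin⟩ := exists_norm_eq_iInf_of_complete_convex hK0.closure
    isClosed_closure.isComplete hK.closure x
  have hproj := (norm_eq_iInf_iff_real_inner_le_zero hK.closure hv).1 hmin
  have hd : ε ≤ ‖x - v‖ :=
    closure_minimal (t := {y | ε ≤ ‖x - y‖}) hx (isClosed_le continuous_const (by fun_prop)) hv
  have hd0 : 0 < ‖x - v‖ := hε.trans_le hd
  refine ⟨‖x - v‖⁻¹ • (x - v), ?_, fun y hy => ?_⟩
  · rw [norm_smul, norm_inv, norm_norm, inv_mul_cancel₀ hd0.ne']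
  · have h1 := hproj y (subset_closure hy)
    have h2 : inner ℝ (x - v) x = inner ℝ (x - v) v + ‖x - v‖ * ‖x - v‖ := by
      rw [← real_inner_self_eq_norm_mul_norm, ← inner_add_right, add_sub_cancel]
    rw [inner_sub_right] at h1
    rw [real_inner_smul_left, real_inner_smul_left, h2, mul_add, inv_mul_cancel_left₀ hd0.ne']
    have h3 : ‖x - v‖⁻¹ * inner ℝ (x - v) y ≤ ‖x - v‖⁻¹ * inner ℝ (x - v) v := by
      gcongr
      linarith
    linarith

/-- The closed convex set cut out by the half-spaces `⟪p, x⟫ ≤ H p`. -/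
def wulffShape (H : E → ℝ) : Set E := {x | ∀ p, inner ℝ p x ≤ H p}

lemma convex_wulffShape (H : E → ℝ) : Convex ℝ (wulffShape H) := by
  have : wulffShape H = ⋂ p, {x | innerSL ℝ p x ≤ H p} := by
    ext
    simp [wulffShape]
  rw [this]
  exact convex_iInter fun p => convex_halfSpace_le (innerSL ℝ p).toLinearMap.isLinear _

lemma isClosed_wulffShape (H : E → ℝ) : IsClosed (wulffShape H) := by
  have : wulffShape H = ⋂ p, {x | inner ℝ p x ≤ H p} := by
    ext
    simp [wulffShape]
  rw [this]
  exact isClosed_iInter fun p => isClosed_le (by fun_prop) continuous_const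

lemma isCompact_wulffShape [ProperSpace E] {H : E → ℝ} {β : ℝ} (hH : ∀ p, H p ≤ ‖p‖ * β) :
    IsCompact (wulffShape H) := by
  refine (isCompact_closedBall (0 : E) (max β 0)).of_isClosed_subset (isClosed_wulffShape H) ?_
  intro x hx
  have h1 := (hx x).trans (hH x)
  rw [real_inner_self_eq_norm_mul_norm] at h1
  rw [mem_closedBall_zero_iff]
  rcases (norm_nonneg x).eq_or_lt with h | h
  · rw [← h]
    exact le_max_right _ _
  · exact (le_of_mul_le_mul_left h1 h).trans (le_max_left _ _)

variable [ProperSpace E] {A : ℝ → Set E} {H : E → ℝ} {β : ℝ}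

/-- Points staying `ε` away along times tending to infinity would have a limit point `x` with `⟪p,
x⟫ ≤ H p` for all `p`, that is, in the Wulff shape. -/
lemma eventually_nearSubset_wulffShape (hA : ∀ᶠ t in atTop, ∀ y ∈ A t, ‖y‖ ≤ β)
    (hH : ∀ p, Tendsto (fun t => supportFun (A t) p) atTop (𝓝 (H p))) {ε : ℝ} (hε : 0 < ε) :
    ∀ᶠ t in atTop, NearSubset ε (A t) (wulffShape H) := by
  by_contra hcon
  obtain ⟨u, hu, hu'⟩ := exists_seq_forall_of_frequently
    ((not_eventually.1 hcon).and_eventually hA)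
  simp only [NearSubset, not_forall, not_exists, not_and, not_le] at hu'
  choose hu1 hbd using hu'
  choose y hy hyD using hu1
  obtain ⟨x, -, φ, hφ, hlim⟩ := (isCompact_closedBall (0 : E) β).tendsto_subseq
    (x := y) fun k => by simpa using hbd k _ (hy k)
  have hx : x ∈ wulffShape H := fun p => by
    have h1 : Tendsto (fun k => supportFun (A (u (φ k))) p) atTop (𝓝 (H p)) :=
      (hH p).comp (hu.comp hφ.tendsto_atTop)
    have h2 : Tendsto (fun k => inner ℝ p (y (φ k))) atTop (𝓝 (inner ℝ p x)) :=
      tendsto_const_nhds.inner hlim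
    exact le_of_tendsto_of_tendsto' h2 h1 fun k => inner_le_supportFun (hbd _) (hy _)
  obtain ⟨k, hk⟩ := (Metric.tendsto_nhds.1 hlim ε hε).exists
  rw [dist_eq_norm] at hk
  exact lt_asymm hk (hyD (φ k) x hx)

/-- Otherwise there are points `x k` of the Wulff shape and unit separating directions `p k`. Along
a subsequence they converge, and `H p₀ + ε ≤ ⟪p₀, x₀⟫ ≤ H p₀` results. Pointwise convergence at `p₀`
suffices, as support functions of sets of radius `β` are `β`-Lipschitz in `p`. -/
lemma eventually_wulffShape_nearSubset (hD : IsCompact (wulffShape H))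
    (hA0 : ∀ᶠ t in atTop, (A t).Nonempty) (hA : ∀ᶠ t in atTop, ∀ y ∈ A t, ‖y‖ ≤ β)
    (hH : ∀ p, Tendsto (fun t => supportFun (A t) p) atTop (𝓝 (H p))) {ε : ℝ} (hε : 0 < ε) :
    ∀ᶠ t in atTop, NearSubset ε (wulffShape H) (convexHull ℝ (A t)) := by
  by_contra hcon
  obtain ⟨u, hu, hu'⟩ := exists_seq_forall_of_frequently
    ((not_eventually.1 hcon).and_eventually (hA0.and hA))
  simp only [NearSubset, not_forall, not_exists, not_and, not_le] at hu'
  choose hu1 hne hbd using hu'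
  choose x hxD hx using hu1
  have hsep : ∀ k, ∃ p : E, ‖p‖ = 1 ∧ supportFun (A (u k)) p + ε ≤ inner ℝ p (x k) := by
    intro k
    obtain ⟨p, hp, h⟩ := exists_unit_separation ((hne k).convexHull (𝕜 := ℝ))
      (convex_convexHull ℝ _) hε fun y hy => (hx k y hy).le
    refine ⟨p, hp, ?_⟩
    rw [← le_sub_iff_add_le]
    exact supportFun_le (hne k) fun y hy => le_sub_iff_add_le.2 (h y (subset_convexHull ℝ _ hy))
  choose p hp hpx using hsep
  obtain ⟨⟨x₀, p₀⟩, ⟨hx₀, -⟩, φ, hφ, hlim⟩ :=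
    (hD.prod (isCompact_closedBall (0 : E) 1)).tendsto_subseq
    (x := fun k => (x k, p k)) fun k => ⟨hxD k, by simp [hp k]⟩
  have hlx : Tendsto (fun k => x (φ k)) atTop (𝓝 x₀) := (continuous_fst.tendsto _).comp hlim
  have hlp : Tendsto (fun k => p (φ k)) atTop (𝓝 p₀) := (continuous_snd.tendsto _).comp hlim
  have h1 : Tendsto (fun k => inner ℝ (p (φ k)) (x (φ k))) atTop (𝓝 (inner ℝ p₀ x₀)) :=
    hlp.inner hlx
  have h2 : Tendsto (fun k => supportFun (A (u (φ k))) p₀ - ‖p₀ - p (φ k)‖ * β + ε) atTop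
      (𝓝 (H p₀ - ‖p₀ - p₀‖ * β + ε)) :=
    ((((hH p₀).comp (hu.comp hφ.tendsto_atTop)).sub
      (((tendsto_const_nhds.sub hlp).norm).mul_const β))).add_const ε
  have h3 := le_of_tendsto_of_tendsto' h2 h1 fun k => by
    have h4 := supportFun_sub_le (hne (φ k)) (hbd (φ k)) p₀ (p (φ k))
    linarith [hpx (φ k)]
  have h5 := hx₀ p₀
  simp only [sub_self, norm_zero, zero_mul, sub_zero] at h3
  linarith

end Separation

/-! ### Real times and the unit cell. -/

section Limit

variable {n : ℕ} {Ω : Type*} {a : EuclideanSpace ℝ (Fin n) → ℝ → Ω → ℝ} {α β : ℝ}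

lemma supportFun_smul {E : Type*} [NormedAddCommGroup E] [InnerProductSpace ℝ E] {c : ℝ}
    (hc : 0 ≤ c) (A : Set E) (p : E) : supportFun (c • A) p = c * supportFun A p := by
  rw [supportFun, supportFun, ← smul_eq_mul, ← Real.sSup_smul_of_nonneg hc]
  congr 1
  rw [← image_smul, ← image_smul, image_image, image_image]
  simp only [real_inner_smul_right, smul_eq_mul]

lemma tendsto_supportFun_smul_of_tendsto_nat (hα0 : 0 ≤ α) (hα : ∀ x r ω, α ≤ a x r ω)
    (hβ : ∀ x r ω, a x r ω ≤ β) {ω : Ω} {p : EuclideanSpace ℝ (Fin n)} {H : ℝ}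
    (h : Tendsto (fun k : ℕ => supportFun (reachFromOrigin a k ω) p / k) atTop (𝓝 H)) :
    Tendsto (fun t : ℝ => supportFun (t⁻¹ • reachFromOrigin a t ω) p) atTop (𝓝 H) := by
  have h1 : Tendsto (fun t : ℝ => supportFun (reachFromOrigin a ⌊t⌋₊ ω) p / ⌊t⌋₊ * (⌊t⌋₊ / t)) atTop
      (𝓝 (H * 1)) :=
    (h.comp tendsto_nat_floor_atTop).mul tendsto_nat_floor_div_atTop
  rw [mul_one] at h1
  have h2 : Tendsto (fun t : ℝ => ‖p‖ * |β| / t) atTop (𝓝 0) := tendsto_const_nhds.div_atTop tendsto_id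
  refine h1.congr_dist (squeeze_zero' (Eventually.of_forall fun _ => dist_nonneg) ?_ h2)
  filter_upwards [eventually_ge_atTop 1] with t ht
  have ht0 : 0 < t := by linarith
  have hf0 : (0 : ℝ) < ⌊t⌋₊ := by exact_mod_cast Nat.floor_pos.2 ht
  have hf1 : (⌊t⌋₊ : ℝ) ≤ t := Nat.floor_le ht0.le
  have hf2 : t - ⌊t⌋₊ ≤ 1 := by linarith [Nat.lt_floor_add_one t]
  have h3 := abs_supportFun_reachFromOrigin_sub_le hα0 hα hβ hf0.le hf1 ω p
  rw [supportFun_smul (inv_nonneg.2 ht0.le), dist_comm, Real.dist_eq]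
  have h4 : t⁻¹ * supportFun (reachFromOrigin a t ω) p
      - supportFun (reachFromOrigin a ⌊t⌋₊ ω) p / ⌊t⌋₊ * (⌊t⌋₊ / t)
      = (supportFun (reachFromOrigin a t ω) p - supportFun (reachFromOrigin a ⌊t⌋₊ ω) p) / t := by
    field_simp
  rw [h4, abs_div, abs_of_pos ht0]
  gcongr
  refine h3.trans ?_
  gcongr
  calc β * (t - ⌊t⌋₊) ≤ |β| * 1 := by
        exact mul_le_mul (le_abs_self β) hf2 (sub_nonneg.2 hf1) (abs_nonneg β)
    _ = |β| := mul_one _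

lemma abs_supportFun_div_sub_le (hα0 : 0 ≤ α) (hα : ∀ x r ω, α ≤ a x r ω)
    (hβ : ∀ x r ω, a x r ω ≤ β) {t : ℝ} (ht : 0 < t) (ω : Ω) (p q : EuclideanSpace ℝ (Fin n)) :
    |supportFun (reachFromOrigin a t ω) p / t - supportFun (reachFromOrigin a t ω) q / t|
      ≤ ‖p - q‖ * β := by
  rw [← sub_div, abs_div, abs_of_pos ht, div_le_iff₀ ht, mul_assoc]
  exact abs_supportFun_sub_le ⟨0, zero_mem_reachFromOrigin hα0 hα ht.le ω⟩
    (norm_le_of_mem_reachFromOrigin hβ ht.le) p q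

lemma norm_le_of_mem_unitCell {x : EuclideanSpace ℝ (Fin n)} (hx : x ∈ unitCell n) :
    ‖x‖ ≤ √n := by
  rw [EuclideanSpace.norm_eq]
  refine Real.sqrt_le_sqrt ?_
  calc ∑ i, ‖x i‖ ^ 2 ≤ ∑ _i : Fin n, (1 : ℝ) := by
        refine Finset.sum_le_sum fun i _ => ?_
        rw [Real.norm_of_nonneg (hx i).1]
        exact pow_le_one₀ (hx i).1 (hx i).2
    _ = n := by simp

lemma zero_mem_unitCell : (0 : EuclideanSpace ℝ (Fin n)) ∈ unitCell n := fun i => by simp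

lemma isCompact_unitCell : IsCompact (unitCell n) := by
  refine (isCompact_closedBall (0 : EuclideanSpace ℝ (Fin n)) √n).of_isClosed_subset ?_
    fun x hx => mem_closedBall_zero_iff.2 (norm_le_of_mem_unitCell hx)
  have : unitCell n = ⋂ i, {x | x i ∈ Icc (0 : ℝ) 1} := by
    ext
    simp [unitCell]
  rw [this]
  exact isClosed_iInter fun i => isClosed_Icc.preimage (by fun_prop)

lemma enlargedReachableSet_eq {K : ℝ≥0} {ω : Ω}
    (hK : LipschitzWith K fun p : EuclideanSpace ℝ (Fin n) × ℝ => a p.1 p.2 ω) (hβ0 : 0 ≤ β)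
    (hβ : ∀ x r, a x r ω ≤ β) {s t : ℝ} (hst : s ≤ t) :
    enlargedReachableSet a t s ω = {y | ∃ x ∈ unitCell n, Reach (fun x r => a x r ω) s t x y} := by
  ext y
  simp only [enlargedReachableSet, mem_iUnion, exists_prop, mem_ofPred_eq,
    mem_reachableSet_iff hK hβ0 hβ hst]

end Limit

/-! ### The limit theorem. -/

theorem mainTheorem3 {n : ℕ} {Ω : Type*} [MeasurableSpace Ω] (μ : Measure Ω)
    [IsProbabilityMeasure μ] (τ : ℤ → Ω → Ω) (hτ : IsErgodicGroup μ τ)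
    (a : EuclideanSpace ℝ (Fin n) → ℝ → Ω → ℝ) (ha : VelocityAssumption τ a) :
    ∃ (D : Set (EuclideanSpace ℝ (Fin n))) (Ω' : Set Ω),
      D.Nonempty ∧ IsCompact D ∧ Convex ℝ D ∧ MeasurableSet Ω' ∧ μ Ω' = 1 ∧
      ∀ ω ∈ Ω',
        (∀ t : ℝ, 0 ≤ t → (enlargedReachableSet a t 0 ω).Nonempty ∧
          IsCompact (enlargedReachableSet a t 0 ω)) ∧
        Tendsto (fun t : ℝ => Metric.hausdorffDist (t⁻¹ • enlargedReachableSet a t 0 ω) D)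
          atTop (𝓝 0) := by
  obtain ⟨α, β, hα0, hβ0, hbd⟩ := ha.bounds
  have hα : ∀ x r ω, α ≤ a x r ω := fun x r ω => (hbd x r ω).1
  have hβ : ∀ x r ω, a x r ω ≤ β := fun x r ω => (hbd x r ω).2
  have hlip := ha.lipschitz
  have ham : ∀ x r, Measurable fun ω => a x r ω := fun x r =>
    ha.measurable.comp (measurable_const.prodMk measurable_id : Measurable fun ω => ((x, r), ω))
  have hS : ∀ x t (k : ℕ) ω, a x t (τ k ω) = a x (t + k) ω := fun x t k ω => by
    have h0 : latticePoint (0 : Fin n → ℤ) = 0 := by ext; simp [latticePoint]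
    simpa [h0] using ha.periodic_stationary x 0 t k ω
  have hper : ∀ (l : Fin n → ℤ) x r ω, a (x + latticePoint l) r ω = a x r ω := fun l x r ω => by
    simpa [hτ.map_zero] using ha.periodic_stationary x l r 0 ω
  obtain ⟨T, hT⟩ := exists_nat_ge (√n / α)
  rw [div_le_iff₀' hα0] at hT
  choose H hH using
    exists_ae_tendsto_supportFun_div hτ hS hper hlip ham hα0 hα hβ0.le hβ hT
  have hHlip : ∀ p q, |H p - H q| ≤ ‖p - q‖ * β := fun p q => by
    obtain ⟨ω, hp, hq⟩ := ((hH p).and (hH q)).exists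
    refine le_of_tendsto (hp.sub hq).abs ?_
    filter_upwards [eventually_gt_atTop 0] with k hk
    exact abs_supportFun_div_sub_le hα0.le hα hβ (by exact_mod_cast hk) ω p q
  -- The null set of `hH` depends on `p`. Equi-Lipschitz dependence on `p` reduces all directions to
  -- countably many, giving one null set.
  obtain ⟨Q, hQc, hQ⟩ := TopologicalSpace.exists_countable_dense (EuclideanSpace ℝ (Fin n))
  have hae : ∀ᵐ ω ∂μ, ∀ p,
      Tendsto (fun k : ℕ => supportFun (reachFromOrigin a k ω) p / k) atTop (𝓝 (H p)) := by
    have hae' := (ae_ball_iff hQc).2 fun p (_ : p ∈ Q) => hH p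
    filter_upwards [hae'] with ω hω p
    rw [Metric.tendsto_nhds]
    intro ε hε
    obtain ⟨q, hq, hpq⟩ := hQ.exists_dist_lt p (show 0 < ε / (4 * β) by positivity)
    rw [dist_eq_norm, lt_div_iff₀ (by positivity)] at hpq
    filter_upwards [Metric.tendsto_nhds.1 (hω q hq) (ε / 2) (by positivity),
      eventually_gt_atTop 0] with k hk hk0
    have h1 := abs_supportFun_div_sub_le hα0.le hα hβ (t := k) (by exact_mod_cast hk0) ω p q
    have h2 := hHlip p q
    rw [Real.dist_eq] at hk ⊢
    rw [abs_lt] at hk ⊢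
    rw [abs_le] at h1 h2
    constructor <;> linarith [h1.1, h1.2, h2.1, h2.2, hk.1, hk.2]
  have hreal : ∀ ω, (∀ p,
      Tendsto (fun k : ℕ => supportFun (reachFromOrigin a k ω) p / k) atTop (𝓝 (H p))) →
      ∀ p, Tendsto (fun t : ℝ => supportFun (t⁻¹ • reachFromOrigin a t ω) p) atTop (𝓝 (H p)) :=
    fun ω hω p => tendsto_supportFun_smul_of_tendsto_nat hα0.le hα hβ (hω p)
  have hHle : ∀ p, H p ≤ ‖p‖ * β := fun p => by
    obtain ⟨ω, hω⟩ := (hH p).exists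
    refine le_of_tendsto hω ?_
    filter_upwards [eventually_gt_atTop 0] with k hk
    rw [div_le_iff₀ (by exact_mod_cast hk), mul_assoc]
    exact (le_abs_self _).trans (abs_supportFun_le
      ⟨0, zero_mem_reachFromOrigin hα0.le hα k.cast_nonneg ω⟩
      (norm_le_of_mem_reachFromOrigin hβ k.cast_nonneg))
  have hD : IsCompact (wulffShape H) := isCompact_wulffShape hHle
  have hbound : ∀ ω, ∀ᶠ t : ℝ in atTop, ∀ y ∈ t⁻¹ • reachFromOrigin a t ω, ‖y‖ ≤ β := fun ω => by
    filter_upwards [eventually_gt_atTop 0] with t ht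
    rintro _ ⟨y, hy, rfl⟩
    have := norm_le_of_mem_reachFromOrigin hβ ht.le y hy
    simp only
    rwa [norm_smul, norm_inv, Real.norm_of_nonneg ht.le, inv_mul_le_iff₀ ht, mul_comm]
  -- The second `√n` accounts for the starting point in the unit cell.
  have hnear : ∀ ω (t : ℝ), 0 ≤ t → T ≤ t →
      NearSubset (β * T + 2 * √n) (enlargedReachableSet a t 0 ω) (reachFromOrigin a t ω) := by
    intro ω t ht hTt y hy
    obtain ⟨K, hK⟩ := hlip ω
    rw [enlargedReachableSet_eq hK hβ0.le (fun x r => hβ x r ω) ht] at hy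
    obtain ⟨x, hx, hxy⟩ := hy
    obtain ⟨y', hy', h⟩ := hxy.exists_near_displacement (fun x r => hα x r ω)
      (fun x r => hβ x r ω) (fun l x r => hper l x r ω) T.cast_nonneg hT (by linarith) 0
    refine ⟨y', hy', ?_⟩
    have h1 : y - y' = x - (y' - 0 - (y - x)) := by abel
    rw [h1]
    exact (norm_sub_le _ _).trans (by linarith [norm_le_of_mem_unitCell hx])
  have hsub : ∀ ω t, 0 ≤ t → reachFromOrigin a t ω ⊆ enlargedReachableSet a t 0 ω := by
    intro ω t ht y hy
    obtain ⟨K, hK⟩ := hlip ω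
    rw [enlargedReachableSet_eq hK hβ0.le (fun x r => hβ x r ω) ht]
    exact ⟨0, zero_mem_unitCell, hy⟩
  have hne : ∀ ω t, 0 ≤ t → (reachFromOrigin a t ω).Nonempty := fun ω t ht =>
    ⟨0, zero_mem_reachFromOrigin hα0.le hα ht ω⟩
  have hDne : (wulffShape H).Nonempty := by
    obtain ⟨ω, hω⟩ := hae.exists
    obtain ⟨t, ht, ht0⟩ := ((eventually_nearSubset_wulffShape (hbound ω) (hreal ω hω)
      one_pos).and (eventually_ge_atTop 0)).exists
    obtain ⟨y, hy⟩ := (hne ω t ht0).smul_set (a := t⁻¹)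
    obtain ⟨z, hz, -⟩ := ht y hy
    exact ⟨z, hz⟩
  obtain ⟨N, hNsub, hNm, hN⟩ := exists_measurable_superset_of_null (ae_iff.1 hae)
  have hgood : ∀ ω ∈ Nᶜ, ∀ p,
      Tendsto (fun k : ℕ => supportFun (reachFromOrigin a k ω) p / k) atTop (𝓝 (H p)) :=
    fun ω hω => by_contra fun h => hω (hNsub h)
  refine ⟨wulffShape H, Nᶜ, hDne, hD, convex_wulffShape H, hNm.compl,
    (prob_compl_eq_one_iff hNm).2 hN, fun ω hω => ⟨?_, ?_⟩⟩
  · intro t ht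
    refine ⟨(hne ω t ht).mono (hsub ω t ht), ?_⟩
    obtain ⟨K, hK⟩ := hlip ω
    rw [enlargedReachableSet_eq hK hβ0.le (fun x r => hβ x r ω) ht]
    exact isCompact_setOf_reach hK hβ0.le (fun x r => hβ x r ω) ht isCompact_unitCell
  have hlim := hreal ω (hgood ω hω)
  rw [Metric.tendsto_nhds]
  intro ε hε
  have hA0 : ∀ᶠ t : ℝ in atTop, (t⁻¹ • reachFromOrigin a t ω).Nonempty := by
    filter_upwards [eventually_ge_atTop 0] with t ht
    exact (hne ω t ht).smul_set
  obtain ⟨t₀, ht₀⟩ := exists_nearSubset_convexHull_reachFromOrigin (S := fun k ω => τ k ω)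
    hS hper hα0.le hα hβ0.le hβ hT (show 0 < ε / 4 by positivity)
  have hC : Tendsto (fun t : ℝ => (β * T + 2 * √n) / t) atTop (𝓝 0) :=
    tendsto_const_nhds.div_atTop tendsto_id
  filter_upwards [eventually_nearSubset_wulffShape (hbound ω) hlim
      (show 0 < ε / 4 by positivity),
    eventually_wulffShape_nearSubset hD hA0 (hbound ω) hlim (show 0 < ε / 4 by positivity),
    eventually_ge_atTop t₀, eventually_gt_atTop 0, eventually_ge_atTop (T : ℝ),
    hC.eventually (gt_mem_nhds (show 0 < ε / 4 by positivity))] with t h1 h2 h3 h4 h5 h6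
  have h7 : NearSubset (ε / 2) (t⁻¹ • enlargedReachableSet a t 0 ω) (wulffShape H) := by
    refine (((hnear ω t h4.le h5).smul t⁻¹).trans h1).mono ?_
    rw [abs_of_pos (inv_pos.2 h4), inv_mul_eq_div]
    linarith
  -- One `ε / 4` leads from the Wulff shape to the convex hull, the other from the hull back to the
  -- reachable set.
  have h8 : NearSubset (ε / 2) (wulffShape H) (t⁻¹ • enlargedReachableSet a t 0 ω) := by
    rw [convexHull_smul] at h2
    refine ((h2.trans ((ht₀ t h3 ω).smul t⁻¹)).trans
      ((nearSubset_of_subset (hsub ω t h4.le)).smul t⁻¹)).mono ?_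
    rw [abs_of_pos (inv_pos.2 h4), mul_zero, add_zero, mul_comm (ε / 4) t,
      inv_mul_cancel_left₀ h4.ne']
    linarith
  rw [Real.dist_0_eq_abs, abs_of_nonneg Metric.hausdorffDist_nonneg]
  refine lt_of_le_of_lt (Metric.hausdorffDist_le_of_mem_dist (r := ε / 2) (by positivity)
    (fun x hx => ?_) fun x hx => ?_) (by linarith)
  · simpa only [dist_eq_norm] using h7 x hx
  · simpa only [dist_eq_norm] using h8 x hx
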